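/- **Setting.** Let $\mathbf k$ be a field and let $P$ be a partition of $n$. Let $n_i$ be the multiplicity of $i$ as a part of $P$, let $S_P=\{i : n_i\neq 0\}$, let $p_1=\max S_P$ and $p_t=\min S_P$, and for $i\in S_P$, $i\ne p_t$, let $i^-$ be the largest element of $S_P$ smaller than $i$. Let $V$ be the $\mathbf k$-vector space whose basis is the set of vertices $(u,i,k)$ with $i\in S_P$, $1\le u\le i$, $1\le k\le n_i$. Let $S_P''$ be the set of minimum elements of those maximal sets of consecutive integers in $S_P$ that have odd cardinality. Consider the linear maps (zero on the basis vectors not mentioned) - $\beta_i(u,i,n_i)=(u,i^-,1)$ and $\alpha_i(u,i^-,n_{i^-})=(u+i-i^-,i,1)$ for $i\in S_P\setminus\{p_t\}$, $1\le u\le i^-$; - $e_{i,k}(u,i,k)=(u,i,k+1)$ for $i\in S_P$, $1\le k<n_i$, $1\le u\le i$; - $w_\ell(u,\ell,n_\ell)=(u+1,\ell,1)$ for $\ell\in S_P''$, $1\le u<\ell$. Let $R$ be the polynomial ring over $\mathbf k$ in the variables $s_i,t_i$ ($i\in S_P\setminus\{p_t\}$), $t_{i,k}$ ($i\in S_P$,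 $1\le k<n_i$) and $z_\ell$ ($\ell\in S_P''$). The *simply adequate* matrix is $$A_R=\sum_{i\in S_P\setminus\{p_t\}}(s_i\beta_i+t_i\alpha_i)+\sum_{i\in S_P,\ 1\le k<n_i}t_{i,k}e_{i,k}+\sum_{\ell\in S_P''}z_\ell w_\ell .$$ The *augmented diagram* has an edge $v\to v'$ whenever one of these maps sends the vertex $v$ to the vertex $v'$; such an edge carries the corresponding variable. A chain of length $r$ in the augmented diagram is a path along edges with $r$ vertices, and its monomial is the product of the variables of its edges. **2-$U$-chains.** Let $\mathfrak A=(a,b)$ with $a,b\in S_P$ and $a\ge b+2$. The vertex set $\{U_{\mathfrak A}\}$ consists of all vertices of the levels $a,a-1,b,b-1$ (the level of $(u,i,k)$ is $i$), and, on every other level $\ell>b$, of the vertices $(u,\ell,k)$ with $u\le c_\ell$ or $u\ge \ell+1-c_\ell$, where $c_\ell$ is the number of elements of $\{a,b\}$ that are smaller than $\ell$. It is the disjoint union of the two component chains $U_{\mathfrak A,\Upsilon}$, $\Upsilon=1,2$; with $a_{(1)}=b$ and $a_{(2)}=a$, the chain $U_{\mathfrak A,\Upsilon}$ passes successively through 1.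 the vertices $(\Upsilon,\ell,k)$ with $\ell>a_{(\Upsilon)}$, by decreasing $\ell$; 2. the vertices $(u,\ell,k)$ with $\ell\in\{a_{(\Upsilon)},a_{(\Upsilon)}-1\}$ and $\Upsilon\le u\le \ell+1-\Upsilon$, by increasing $u$, and for each $u$ first those with $\ell=a_{(\Upsilon)}$ and then those with $\ell=a_{(\Upsilon)}-1$; 3. the vertices $(\ell+1-\Upsilon,\ell,k)$ with $\ell>a_{(\Upsilon)}$, by increasing $\ell$; where for fixed $u,\ell$ the vertices are passed by increasing $k$. Let $v_{\Upsilon,j}$ be its $j$-th vertex and $|U_{\mathfrak A,\Upsilon}|$ its number of vertices. The 2-$U$-chain $U_{\mathfrak A}$ is *maximal* if there is no pair $\mathfrak A'=(a',b')$, $a',b'\in S_P$, $a'\ge b'+2$, such that $\{U_{\mathfrak A}\}$ is a proper subset of $\{U_{\mathfrak A'}\}$. **The matrix and its chain factorizations.** Let $M_{\mathfrak A}$ be the square matrix over $R$ with rows and columns both indexed by the pairs $(\Upsilon,u)$, $\Upsilon\in\{1,2\}$, $0\le u<|U_{\mathfrak A,\Upsilon}|$, whose entry in row $(\Upsilon,u)$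 and column $(\Upsilon',u')$ is the coefficient of $A_R^{\,u}(v_{\Upsilon,1})$ on $v_{\Upsilon',u'+1}$. The *standard chain* to $v_{\Upsilon,u+1}$ is the initial portion $v_{\Upsilon,1}\to\dots\to v_{\Upsilon,u+1}$ of $U_{\mathfrak A,\Upsilon}$, and $\mu_{\mathfrak A}$ is the product of the monomials of the standard chains to all the $v_{\Upsilon,u+1}$. An *$\mathfrak A$-chain factorization* of $\pm\nu$, where $\nu$ is a monomial of $R$, is a triple $f=(\nu_f,\sigma_f,C_f)$ in which $\sigma_f$ is a permutation of $\{U_{\mathfrak A}\}$, $C_f$ is an array of chains $c_{\Upsilon,u}$ of length $u+1$ in the augmented diagram from $v_{\Upsilon,1}$ to $\sigma_f(v_{\Upsilon,u+1})$, and $\nu_f$ is the array of the monomials $\nu_{\Upsilon,u}$ of these chains, such that $\prod_{\Upsilon,u}\nu_{\Upsilon,u}=\nu$. **Proposition 3.5.** Let $U_{\mathfrak A}=U_{a,b}$ be a maximal 2-$U$-chain. Then the triple $g_{\mathfrak A}$ formed by the identity permutation, the standard chains and their monomials is a chain factorization of $\pm\mu_{\mathfrak A}$, and it is the only one: if $f=(\nu_f,\sigma_f,C_f)$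 is any $\mathfrak A$-chain factorization of $\pm\mu_{\mathfrak A}$, then $f=g_{\mathfrak A}$, that is, $\sigma_f=\mathrm{id}$ and every $c_{\Upsilon,u}$ is the standard chain from $v_{\Upsilon,1}$ to $v_{\Upsilon,u+1}$. The coefficient of $\mu_{\mathfrak A}$ in $\det M_{\mathfrak A}$ is $1$. -/

import Mathlib

namespace JordanBound

/-! ### The partition, its levels, and the vertices of the poset -/

/-- The multiplicity `n_i` of `i` as a part of `P`. -/
def mult {n : ℕ} (P : n.Partition) (i : ℕ) : ℕ := P.parts.count i

/-- `S_P`, the set of integers that occur as parts of `P`. -/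
def levels {n : ℕ} (P : n.Partition) : Finset ℕ := P.parts.toFinset

/-- The triples `(u, i, k)` with `i ∈ S_P`, `1 ≤ u ≤ i`, `1 ≤ k ≤ n_i`. -/
def vertices {n : ℕ} (P : n.Partition) : Finset (ℕ × ℕ × ℕ) :=
  (levels P).biUnion fun i => Finset.Icc 1 i ×ˢ ({i} ×ˢ Finset.Icc 1 (mult P i))

/-- The vertices of `D_P`; they are also the distinguished basis of the space on which
`n × n` matrices act, `(u, i, k) = B ^ (u - 1) (1, i, k)`. -/
abbrev Vertex {n : ℕ} (P : n.Partition) : Type := {v : ℕ × ℕ × ℕ // v ∈ vertices P}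

namespace Vertex

variable {n : ℕ} {P : n.Partition}

/-- The entry `u` of the vertex `(u, i, k)`. -/
def pos (v : Vertex P) : ℕ := v.1.1

/-- The level `i` of the vertex `(u, i, k)`. -/
def level (v : Vertex P) : ℕ := v.1.2.1

/-- The entry `k` of the vertex `(u, i, k)`. -/
def height (v : Vertex P) : ℕ := v.1.2.2

end Vertex

/-- The levels `i ∈ S_P` that are not the smallest part of `P`. -/
def upperLevels {n : ℕ} (P : n.Partition) : Finset ℕ :=
  (levels P).filter fun i => ∃ j ∈ levels P, j < i

/-- `i⁻`, the largest element of `S_P` below `i` (used only for `i ∈ upperLevels P`). -/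
def prevLevel {n : ℕ} (P : n.Partition) (i : ℕ) : ℕ :=
  ((levels P).filter fun j => j < i).sup id

/-- `{ℓ, ℓ + 1, …, m}` is a maximal consecutive subsequence of `S_P`. -/
def IsMCS {n : ℕ} (P : n.Partition) (ℓ m : ℕ) : Prop :=
  ℓ ≤ m ∧ Finset.Icc ℓ m ⊆ levels P ∧ ℓ - 1 ∉ levels P ∧ m + 1 ∉ levels P

instance {n : ℕ} (P : n.Partition) (ℓ m : ℕ) : Decidable (IsMCS P ℓ m) := by
  unfold IsMCS; infer_instance

/-- `S_P''`, the minimum elements of the maximal consecutive subsequences of `S_P` of odd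
cardinality. -/
def oddMinima {n : ℕ} (P : n.Partition) : Finset ℕ :=
  (levels P).filter fun ℓ => ∃ m ∈ levels P, IsMCS P ℓ m ∧ Odd (Finset.Icc ℓ m).card

/-! ### The augmented diagram, the polynomial ring and the simply adequate matrix -/

/-- The variables `s_i`, `t_i`, `t_{i,k}`, `z_ℓ` of the polynomial ring `R`. The variable
`e i k` is `t_{i,k+1}`, for `1 ≤ k + 1 < n_i`. -/
inductive Var {n : ℕ} (P : n.Partition) : Type
  | s (i : {i // i ∈ upperLevels P}) : Var P
  | t (i : {i // i ∈ upperLevels P}) : Var P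
  | e (i : {i // i ∈ levels P}) (k : Fin (mult P i - 1)) : Var P
  | z (ℓ : {ℓ // ℓ ∈ oddMinima P}) : Var P
  deriving Fintype

/-- `Step x v w` says that the map attached to the variable `x` (which is `β_i` for `s_i`,
`α_i` for `t_i`, `e_{i,k}` for `t_{i,k}`, and `w_ℓ` for `z_ℓ`) sends the basis vector `v` to
the basis vector `w`:
* `β_i (u, i, n_i) = (u, i⁻, 1)` for `1 ≤ u ≤ i⁻`;
* `α_i (u, i⁻, n_{i⁻}) = (u + i - i⁻, i, 1)` for `1 ≤ u ≤ i⁻`;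
* `e_{i,k} (u, i, k) = (u, i, k + 1)` for `1 ≤ u ≤ i` and `1 ≤ k < n_i`;
* `w_ℓ (u, ℓ, n_ℓ) = (u + 1, ℓ, 1)` for `1 ≤ u < ℓ`.
All the other basis vectors are sent to zero. The bounds on `u` hold because `v` and `w` are
vertices. -/
def Step {n : ℕ} (P : n.Partition) : Var P → Vertex P → Vertex P → Prop
  | .s i, v, w =>
      v.level = i ∧ v.height = mult P i ∧
      w.level = prevLevel P i ∧ w.height = 1 ∧ w.pos = v.pos
  | .t i, v, w =>
      v.level = prevLevel P i ∧ v.height = mult P (prevLevel P i) ∧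
      w.level = i ∧ w.height = 1 ∧ w.pos + prevLevel P i = v.pos + i
  | .e i k, v, w =>
      v.level = i ∧ v.height = k + 1 ∧ w.level = i ∧ w.height = k + 2 ∧ w.pos = v.pos
  | .z ℓ, v, w =>
      v.level = ℓ ∧ v.height = mult P ℓ ∧ w.level = ℓ ∧ w.height = 1 ∧ w.pos = v.pos + 1

instance {n : ℕ} (P : n.Partition) (x : Var P) (v w : Vertex P) : Decidable (Step P x v w) := by
  cases x <;> unfold Step <;> infer_instance

/-- The edges of the augmented diagram of `D_P`. (An isolated `ℓ ∈ S_P` lies in `S_P''`, so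
the edges of `w_ℓ` with `ℓ` isolated are among those listed.) -/
def AugEdge {n : ℕ} (P : n.Partition) (v w : Vertex P) : Prop := ∃ x : Var P, Step P x v w

/-- The matrix of the map attached to the variable `x`; the entry at `(v, w)` is the
coefficient of the image of `v` on `w`. -/
def stepMatrix {n : ℕ} (P : n.Partition) (S : Type*) [CommRing S] (x : Var P) :
    Matrix (Vertex P) (Vertex P) S :=
  Matrix.of fun v w => if Step P x v w then 1 else 0

/-- The simply adequate matrix
`A_R = ∑ (s_i β_i + t_i α_i) + ∑ t_{i,k} e_{i,k} + ∑ z_ℓ w_ℓ`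
over the polynomial ring `R = k[s_i, t_i, t_{i,k}, z_ℓ]`. -/
noncomputable def simplyAdequate {n : ℕ} (P : n.Partition) (𝕜 : Type*) [Field 𝕜] :
    Matrix (Vertex P) (Vertex P) (MvPolynomial (Var P) 𝕜) :=
  ∑ x : Var P, (MvPolynomial.X x : MvPolynomial (Var P) 𝕜) • stepMatrix P _ x

/-- The exponent vector of the variable attached to the edge `v → w`. -/
noncomputable def edgeExp {n : ℕ} (P : n.Partition) (v w : Vertex P) : Var P →₀ ℕ :=
  ∑ x : Var P, if Step P x v w then Finsupp.single x 1 else 0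

/-- The exponent vector of the monomial `μ_p` of a chain `p`, the product of the variables
attached to the edges of `p`. -/
noncomputable def chainExp {n : ℕ} (P : n.Partition) : List (Vertex P) → (Var P →₀ ℕ)
  | [] => 0
  | [_] => 0
  | v :: w :: p => edgeExp P v w + chainExp P (w :: p)

/-- `p` is a chain with `r` vertices from `v` to `w` in the augmented diagram. -/
def IsAugChain {n : ℕ} (P : n.Partition) (p : List (Vertex P)) (r : ℕ) (v w : Vertex P) : Prop :=
  p.IsChain (AugEdge P) ∧ p.length = r ∧ p.head? = some v ∧ p.getLast? = some w

/-! ### The multi-U-chains -/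

/-- The `s`-tuples `(a_1, …, a_s)` of elements of `S_P` with `a_i ≥ a_{i+1} + 2`, which label
the `s`-U-chains. The entry `a_i` is `𝔄 (i - 1)`. -/
def IsUTuple {n s : ℕ} (P : n.Partition) (𝔄 : Fin s → ℕ) : Prop :=
  (∀ i, 𝔄 i ∈ levels P) ∧ ∀ i j : Fin s, i < j → 𝔄 j + 2 ≤ 𝔄 i

/-- The vertex set `{U_𝔄}` of the `s`-U-chain of `𝔄`: all vertices of the levels `a_i` and
`a_i - 1`, and on every other level `ℓ > a_s` the vertices `(u, ℓ, k)` with `u ≤ c` or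
`u ≥ ℓ + 1 - c`, where `c` is the number of `i` with `a_i < ℓ`. -/
def uSet {n s : ℕ} (P : n.Partition) (𝔄 : Fin s → ℕ) : Set (Vertex P) :=
  {v | (∃ i, v.level = 𝔄 i ∨ v.level + 1 = 𝔄 i) ∨
    ((∃ i, 𝔄 i < v.level) ∧
      (v.pos ≤ (Finset.univ.filter fun i => 𝔄 i < v.level).card ∨
        v.level + 1 ≤ v.pos + (Finset.univ.filter fun i => 𝔄 i < v.level).card))}

/-- The `s`-U-chain of `𝔄` is maximal: its vertex set is not a proper subset of that of
another `s`-U-chain. -/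
def IsMaximalUTuple {n s : ℕ} (P : n.Partition) (𝔄 : Fin s → ℕ) : Prop :=
  IsUTuple P 𝔄 ∧ ∀ 𝔄' : Fin s → ℕ, IsUTuple P 𝔄' → ¬ uSet P 𝔄 ⊂ uSet P 𝔄'

/-- The vertices `(u, i, 1), …, (u, i, n_i)` in this order; the empty list when `i ∉ S_P` or
`u` is not in `{1, …, i}`. -/
def column {n : ℕ} (P : n.Partition) (u i : ℕ) : List (Vertex P) :=
  if h : 1 ≤ u ∧ u ≤ i then
    (List.finRange (mult P i)).map fun k : Fin (mult P i) => ⟨(u, i, (k : ℕ) + 1), by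
      have hk : 0 < mult P i := lt_of_le_of_lt (Nat.zero_le _) k.2
      simp only [vertices, Finset.mem_biUnion, Finset.mem_product, Finset.mem_Icc,
        Finset.mem_singleton]
      exact ⟨i, Multiset.mem_toFinset.2 (Multiset.count_pos.1 hk), h, rfl,
        Nat.succ_le_succ (Nat.zero_le _), k.2⟩⟩
  else []

/-- The chain, listed from its initial to its terminal vertex, made of
* the left hook, the vertices `(r, ℓ, k)` with `ℓ > c`, by decreasing level `ℓ`;
* the vertices `(u, ℓ, k)` with `ℓ ∈ {c, c - 1}` and `r ≤ u ≤ ℓ + 1 - r`, by increasing `u`,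
  and for a given `u` first those of level `c`, then those of level `c - 1`;
* the right hook, the vertices `(ℓ + 1 - r, ℓ, k)` with `ℓ > c`, by increasing level `ℓ`;
each column being passed by increasing `k`. (All the parts of `P ⊢ n` are at most `n`.) -/
def hookChain {n : ℕ} (P : n.Partition) (r c : ℕ) : List (Vertex P) :=
  ((List.range' (c + 1) (n - c)).reverse.flatMap fun ℓ => column P r ℓ) ++
  ((List.range' r (c + 2 - 2 * r)).flatMap fun u =>
    column P u c ++ if u + r ≤ c then column P u (c - 1) else []) ++
  ((List.range' (c + 1) (n - c)).flatMap fun ℓ => column P (ℓ + 1 - r) ℓ)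

/-- The component chain `U_{𝔄,Υ}`, where `Υ = r + 1`, of the `s`-U-chain of `𝔄`, counted from
the outside: it turns at the level `a_{s+1-Υ}`. -/
def component {n s : ℕ} (P : n.Partition) (𝔄 : Fin s → ℕ) (r : Fin s) : List (Vertex P) :=
  hookChain P (r + 1) (𝔄 r.rev)

/-! ### The matrix `M_𝔄` and the chain factorizations -/

/-- The pairs `(Υ, u)` with `1 ≤ Υ ≤ s`, `0 ≤ u < |U_{𝔄,Υ}|` (`Υ` is shifted to start
at `0`). They label the rows `x ^ u ⊗ v_{𝔄,Υ,1}` and the columns `v_{𝔄,Υ,u+1}` of `M_𝔄`, that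
is, rows and columns are identified through the bijection `η`. -/
abbrev Idx {n s : ℕ} (P : n.Partition) (𝔄 : Fin s → ℕ) : Type :=
  (r : Fin s) × Fin (component P 𝔄 r).length

/-- The vertex `v_{𝔄,Υ,u+1}`. -/
def vert {n s : ℕ} (P : n.Partition) (𝔄 : Fin s → ℕ) (x : Idx P 𝔄) : Vertex P :=
  (component P 𝔄 x.1).get x.2

/-- The initial vertex `v_{𝔄,Υ,1}` of the component chain of the index `(Υ, u)`. -/
def initVert {n s : ℕ} (P : n.Partition) (𝔄 : Fin s → ℕ) (x : Idx P 𝔄) : Vertex P :=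
  (component P 𝔄 x.1).get ⟨0, x.2.pos⟩

/-- The matrix `M_𝔄`: its entry in the row `x ^ u ⊗ v_{𝔄,Υ,1}` and the column `v` is the
coefficient of `A_R ^ u (v_{𝔄,Υ,1})` on `v`. -/
noncomputable def uMatrix {n s : ℕ} (P : n.Partition) (𝔄 : Fin s → ℕ) (𝕜 : Type*) [Field 𝕜] :
    Matrix (Idx P 𝔄) (Idx P 𝔄) (MvPolynomial (Var P) 𝕜) :=
  Matrix.of fun x y => (simplyAdequate P 𝕜 ^ (x.2 : ℕ)) (initVert P 𝔄 x) (vert P 𝔄 y)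

/-- The standard chain from `v_{𝔄,Υ,1}` to `v_{𝔄,Υ,u+1}`. -/
def standardChain {n s : ℕ} (P : n.Partition) (𝔄 : Fin s → ℕ) (x : Idx P 𝔄) : List (Vertex P) :=
  (component P 𝔄 x.1).take (x.2 + 1)

/-- The exponent vector of the distinguished monomial `μ_𝔄`, the product of the monomials of
all the standard chains. -/
noncomputable def distinguishedExp {n s : ℕ} (P : n.Partition) (𝔄 : Fin s → ℕ) : Var P →₀ ℕ :=
  ∑ x : Idx P 𝔄, chainExp P (standardChain P 𝔄 x)

/-- A triple `(ν_f, σ_f, C_f)` of an array of monomials (given by their exponent vectors), a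
permutation of the vertices `v_{𝔄,Υ,u+1}` (given by the permutation of their indices), and an
array of sequences of vertices. -/
@[ext]
structure Triple {n s : ℕ} (P : n.Partition) (𝔄 : Fin s → ℕ) where
  mono : Idx P 𝔄 → (Var P →₀ ℕ)
  perm : Equiv.Perm (Idx P 𝔄)
  chain : Idx P 𝔄 → List (Vertex P)

/-- The triple `f` is a chain factorization of the signed monomial `± ν`, where `m` is the
exponent vector of `ν`. -/
structure IsChainFactorization {n s : ℕ} (P : n.Partition) (𝔄 : Fin s → ℕ)
    (f : Triple P 𝔄) (m : Var P →₀ ℕ) : Prop where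
  /-- `c_{Υ,u,f}` is a chain of length `u + 1` from `v_{𝔄,Υ,1}` to `σ_f (v_{𝔄,Υ,u+1})`. -/
  isAugChain : ∀ x, IsAugChain P (f.chain x) (x.2 + 1) (initVert P 𝔄 x) (vert P 𝔄 (f.perm x))
  /-- `ν_{Υ,u,f}` is the monomial of the chain `c_{Υ,u,f}`. -/
  mono_eq : ∀ x, f.mono x = chainExp P (f.chain x)
  /-- `ν` is, up to sign, the product of the monomials `ν_{Υ,u,f}`. -/
  prod_eq : ∑ x, f.mono x = m

/-- The standard triple `g_𝔄`: the identity permutation, the standard chains and their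
monomials. -/
noncomputable def standardTriple {n s : ℕ} (P : n.Partition) (𝔄 : Fin s → ℕ) : Triple P 𝔄 where
  mono x := chainExp P (standardChain P 𝔄 x)
  perm := 1
  chain := standardChain P 𝔄

end JordanBound

/-!
The uniqueness of the chain factorization is proved by linear programming duality. Give each
variable a weight and each vertex a potential, with values in `ℤ ×ₗ ℤ`, such that along every edge
the potential increases by at most the weight of its variable. Then a chain from `v` to `w` has
weight at least the difference of the potentials, with equality only if all of its edges are
tight. In a chain factorization of `± μ_𝔄` the initial vertices, the set of the end points and the
product of the monomials are those of the standard triple. So if the standard chains are tight, all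
chains of the factorization are tight as well. If moreover each vertex of the two component
chains has at most one tight predecessor, and the initial vertices have none, then each chain can
be traced back from its end: it is the standard chain to that vertex. Its initial vertex and its
length then show that the permutation is the identity (`eq_standardTriple_of_potential`). The
coefficient of `μ_𝔄` in the determinant is the signed number of chain factorizations
(`coeff_det_eq_one`).

The potential (`potMain`, `potFine`) is found by imagining that a move to the right costs twice its
length, that moves on the levels `b` and `b - 1` are free, and that entering the upper levels from
`b` costs just so much that only the right border `u = ℓ` is reached more cheaply through `b` than
on the way of the inner chain. The second component breaks the remaining ties: it makes the inner
chain descend to the level `a`, and the outer chain start on the left border. The tight edges into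
the vertices of the component chains are found in `tight_cases` and `tight_pred_unique`.

The maximality of `(a, b)` is needed only for the standard chains to exist: it provides the edges
`w_a`, `w_b` when `a - 1` or `b - 1` is not a part (`mem_oddMinima_upper`, `mem_oddMinima_lower`).
-/

namespace JordanBound

variable {n : ℕ} {P : n.Partition}

/-! ### Levels, edges and their variables -/

lemma prevLevel_facts {i : ℕ} (hi : i ∈ upperLevels P) :
    i ∈ levels P ∧ prevLevel P i ∈ levels P ∧ prevLevel P i < i ∧
      ∀ j ∈ levels P, j < i → j ≤ prevLevel P i := by
  obtain ⟨hiS, j, hj, hji⟩ := Finset.mem_filter.1 hi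
  have hne : ((levels P).filter fun j => j < i).Nonempty := ⟨j, Finset.mem_filter.2 ⟨hj, hji⟩⟩
  obtain ⟨m, hm, hme⟩ := Finset.exists_mem_eq_sup _ hne id
  have hm' : prevLevel P i = m := hme
  rw [hm']
  refine ⟨hiS, (Finset.mem_filter.1 hm).1, (Finset.mem_filter.1 hm).2, fun k hk hki => ?_⟩
  rw [← hm']
  exact Finset.le_sup (f := id) (Finset.mem_filter.2 ⟨hk, hki⟩)

lemma Step.unique {x y : Var P} {v w : Vertex P} (hx : Step P x v w) (hy : Step P y v w) :
    x = y := by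
  -- an edge is classified by the signs of the changes of level, position and height
  have aux : ∀ {x : Var P}, Step P x v w →
      (∃ i, x = .s i ∧ w.level < v.level ∧ v.level = i) ∨
      (∃ i, x = .t i ∧ v.level < w.level ∧ w.level = i) ∨
      (∃ i k, x = .e i k ∧ v.level = w.level ∧ w.pos = v.pos ∧ v.level = i ∧
        v.height = k + 1) ∨
      (∃ i, x = .z i ∧ v.level = w.level ∧ w.pos = v.pos + 1 ∧ v.level = i) := by
    rintro (i | i | ⟨i, k⟩ | i) ⟨h1, h2, h3, h4, h5⟩
    · have := prevLevel_facts i.2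
      exact .inl ⟨i, rfl, by omega, h1⟩
    · have := prevLevel_facts i.2
      exact .inr (.inl ⟨i, rfl, by omega, h3⟩)
    · exact .inr (.inr (.inl ⟨i, k, rfl, by omega, h5, h1, h2⟩))
    · exact .inr (.inr (.inr ⟨i, rfl, by omega, h5, h1⟩))
  rcases aux hx with ⟨i, rfl, h1, h2⟩ | ⟨i, rfl, h1, h2⟩ | ⟨i, k, rfl, h1, h2, h3, h4⟩ |
      ⟨i, rfl, h1, h2, h3⟩ <;>
    rcases aux hy with ⟨j, rfl, g1, g2⟩ | ⟨j, rfl, g1, g2⟩ | ⟨j, l, rfl, g1, g2, g3, g4⟩ |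
      ⟨j, rfl, g1, g2, g3⟩ <;>
    first
    | (exfalso; omega)
    | (obtain rfl : i = j := Subtype.ext (by omega)
       first
       | rfl
       | (obtain rfl : k = l := Fin.ext (by omega)
          rfl))

lemma edgeExp_eq_single {x : Var P} {v w : Vertex P} (h : Step P x v w) :
    edgeExp P v w = Finsupp.single x 1 := by
  classical
  rw [edgeExp, Finset.sum_eq_single x]
  · rw [if_pos h]
  · intro y _ hy
    rw [if_neg fun h' => hy (h'.unique h)]
  · simp

/-! ### Chains in the augmented diagram -/

lemma chainExp_cons {v w : Vertex P} {p : List (Vertex P)} (h : p.head? = some w) :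
    chainExp P (v :: p) = edgeExp P v w + chainExp P p := by
  cases p with
  | nil => simp at h
  | cons w' p =>
    obtain rfl : w' = w := by simpa using h
    rfl

open Classical in
lemma simplyAdequate_apply (𝕜 : Type*) [Field 𝕜] (v w : Vertex P) :
    simplyAdequate P 𝕜 v w =
      if AugEdge P v w then MvPolynomial.monomial (edgeExp P v w) 1 else 0 := by
  have key : simplyAdequate P 𝕜 v w =
      ∑ x : Var P, if Step P x v w then (MvPolynomial.X x : MvPolynomial (Var P) 𝕜) else 0 := by
    simp [simplyAdequate, stepMatrix, Matrix.sum_apply]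
  rw [key]
  split_ifs with h
  · obtain ⟨x, hx⟩ := h
    rw [Finset.sum_eq_single x]
    · rw [if_pos hx, edgeExp_eq_single hx]; rfl
    · intro y _ hy
      rw [if_neg fun h' => hy (h'.unique hx)]
    · simp
  · exact Finset.sum_eq_zero fun x _ => if_neg fun hx => h ⟨x, hx⟩

/-- The entry of `A_R ^ u` at `(v, w)` is the sum of the monomials of the chains with `u + 1`
vertices from `v` to `w`, of which there are finitely many. -/
lemma exists_chains_pow_apply (𝕜 : Type*) [Field 𝕜] (u : ℕ) (v w : Vertex P) :
    ∃ C : Finset (List (Vertex P)), (∀ p, p ∈ C ↔ IsAugChain P p (u + 1) v w) ∧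
      (simplyAdequate P 𝕜 ^ u) v w = ∑ p ∈ C, MvPolynomial.monomial (chainExp P p) 1 := by
  classical
  induction u generalizing v with
  | zero =>
    refine ⟨if v = w then {[v]} else ∅, fun p => ?_, ?_⟩
    · rcases p with _ | ⟨x, _ | ⟨y, p⟩⟩
      · split_ifs <;> simp [IsAugChain]
      · split_ifs with h
        · subst h; simp [IsAugChain]
        · simp only [Finset.notMem_empty, IsAugChain, List.head?_cons, Option.some.injEq,
            List.getLast?_singleton, false_iff]
          rintro ⟨-, -, rfl, h'⟩; exact h h'
      · split_ifs <;> simp [IsAugChain]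
    · rw [pow_zero, Matrix.one_apply]
      split_ifs with h
      · simp [chainExp]
      · simp
  | succ u ih =>
    choose C hC hA using ih
    refine ⟨(Finset.univ.filter fun v' => AugEdge P v v').biUnion
      fun v' => (C v').image (List.cons v), fun p => ?_, ?_⟩
    · simp only [Finset.mem_biUnion, Finset.mem_filter, Finset.mem_univ, true_and,
        Finset.mem_image, hC]
      constructor
      · rintro ⟨v', hv, q, ⟨h1, h2, h3, h4⟩, rfl⟩
        cases q with
        | nil => simp at h3
        | cons y q =>
          obtain rfl : y = v' := by simpa using h3
          refine ⟨List.isChain_cons_cons.2 ⟨hv, h1⟩, by simpa using h2, rfl, ?_⟩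
          rw [List.getLast?_cons_cons]; exact h4
      · rintro ⟨h1, h2, h3, h4⟩
        rcases p with _ | ⟨x, _ | ⟨y, q⟩⟩
        · simp at h3
        · simp at h2
        · obtain rfl : x = v := by simpa using h3
          rw [List.isChain_cons_cons] at h1
          refine ⟨y, h1.1, y :: q, ⟨h1.2, by simpa using h2, rfl, ?_⟩, rfl⟩
          rw [List.getLast?_cons_cons] at h4; exact h4
    · rw [pow_succ', Matrix.mul_apply, Finset.sum_biUnion, Finset.sum_filter]
      · refine Finset.sum_congr rfl fun v' _ => ?_
        rw [simplyAdequate_apply, hA]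
        split_ifs with h
        · rw [Finset.sum_image fun _ _ _ _ h => (List.cons.inj h).2, Finset.mul_sum]
          refine Finset.sum_congr rfl fun p hp => ?_
          rw [chainExp_cons ((hC v' p).1 hp).2.2.1, MvPolynomial.monomial_mul, one_mul]
        · rw [zero_mul]
      · intro x _ y _ hxy
        refine Finset.disjoint_left.2 fun p hx hy => hxy ?_
        obtain ⟨q, hq, rfl⟩ := Finset.mem_image.1 hx
        obtain ⟨q', hq', h⟩ := Finset.mem_image.1 hy
        obtain rfl := (List.cons.inj h).2
        have h1 := ((hC _ _).1 hq).2.2.1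
        have h2 := ((hC _ _).1 hq').2.2.1
        exact Option.some.inj (h1.symm.trans h2)

/-- If the standard triple is the only chain factorization of `± μ_𝔄`, then `μ_𝔄` occurs in the
Leibniz expansion of `det M_𝔄` exactly once, in the term of the identity permutation. -/
lemma coeff_det_eq_one {s : ℕ} {𝔄 : Fin s → ℕ} (𝕜 : Type*) [Field 𝕜]
    (hstd : IsChainFactorization P 𝔄 (standardTriple P 𝔄) (distinguishedExp P 𝔄))
    (huniq : ∀ f : Triple P 𝔄, IsChainFactorization P 𝔄 f (distinguishedExp P 𝔄) →
      f = standardTriple P 𝔄) :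
    MvPolynomial.coeff (distinguishedExp P 𝔄) (uMatrix P 𝔄 𝕜).det = 1 := by
  classical
  have hex : ∀ x y : Idx P 𝔄, ∃ C : Finset (List (Vertex P)),
      (∀ p, p ∈ C ↔ IsAugChain P p (x.2 + 1) (initVert P 𝔄 x) (vert P 𝔄 y)) ∧
      uMatrix P 𝔄 𝕜 x y = ∑ p ∈ C, MvPolynomial.monomial (chainExp P p) 1 :=
    fun x y => exists_chains_pow_apply 𝕜 _ _ _
  choose C hC hM using hex
  -- the coefficient in each product is the number of chain factorizations with that permutation
  have hcoeff : ∀ σ : Equiv.Perm (Idx P 𝔄),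
      MvPolynomial.coeff (distinguishedExp P 𝔄) (∏ x, uMatrix P 𝔄 𝕜 x (σ x)) =
        if σ = 1 then 1 else 0 := by
    intro σ
    simp only [hM, Finset.prod_univ_sum, MvPolynomial.coeff_sum]
    have hmon : ∀ g : Idx P 𝔄 → List (Vertex P),
        ∏ x, (MvPolynomial.monomial (chainExp P (g x)) (1 : 𝕜)) =
          MvPolynomial.monomial (∑ x, chainExp P (g x)) 1 := by
      intro g
      rw [MvPolynomial.monomial_sum_one]
    simp only [hmon, MvPolynomial.coeff_monomial]
    have hfac : ∀ g ∈ Fintype.piFinset fun x => C x (σ x),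
        ∑ x, chainExp P (g x) = distinguishedExp P 𝔄 →
          σ = 1 ∧ g = standardChain P 𝔄 := by
      intro g hg hsum
      have := huniq ⟨fun x => chainExp P (g x), σ, g⟩
        ⟨fun x => (hC _ _ _).1 (Fintype.mem_piFinset.1 hg x), fun _ => rfl, hsum⟩
      exact ⟨congrArg Triple.perm this, congrArg Triple.chain this⟩
    split_ifs with hσ
    · subst hσ
      rw [Finset.sum_eq_single (standardChain P 𝔄)]
      · exact if_pos rfl
      · intro g hg hne
        rw [if_neg fun h => hne (hfac g hg h).2]
      · intro h
        exact absurd (Fintype.mem_piFinset.2 fun x => (hC _ _ _).2 (hstd.isAugChain x)) h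
    · refine Finset.sum_eq_zero fun g hg => if_neg fun h => hσ (hfac g hg h).1
  rw [← Matrix.det_transpose, Matrix.det_apply, MvPolynomial.coeff_sum, Finset.sum_eq_single 1]
  · simpa using hcoeff 1
  · intro σ _ hσ
    simp only [Matrix.transpose_apply]
    rw [MvPolynomial.coeff_smul, hcoeff, if_neg hσ, smul_zero]
  · simp

/-! ### Potentials -/

/-- The additive extension of a weight on the variables to exponent vectors. -/
noncomputable def weight {Γ : Type*} [AddCommGroup Γ] (cost : Var P → Γ) :
    (Var P →₀ ℕ) →+ Γ :=
  Finsupp.liftAddHom fun x => multiplesHom Γ (cost x)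

/-- The edge `v → w` is tight for a weight and a potential: the potential increases along it by
exactly the weight of its variable. -/
def Tight {Γ : Type*} [AddCommGroup Γ] (cost : Var P → Γ) (pot : Vertex P → Γ)
    (v w : Vertex P) : Prop :=
  ∃ x, Step P x v w ∧ pot w = pot v + cost x

lemma weight_edgeExp {Γ : Type*} [AddCommGroup Γ] (cost : Var P → Γ) {x : Var P}
    {v w : Vertex P} (h : Step P x v w) : weight cost (edgeExp P v w) = cost x := by
  simp [edgeExp_eq_single h, weight]

section Potential

variable {Γ : Type*} [AddCommGroup Γ] [LinearOrder Γ] [IsOrderedAddMonoid Γ]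
  {cost : Var P → Γ} {pot : Vertex P → Γ}

lemma pot_le_of_chain (hfeas : ∀ x v w, Step P x v w → pot w ≤ pot v + cost x)
    {p : List (Vertex P)} {v w : Vertex P} (hp : p.IsChain (AugEdge P))
    (hv : p.head? = some v) (hw : p.getLast? = some w) :
    pot w ≤ pot v + weight cost (chainExp P p) ∧
      (pot w = pot v + weight cost (chainExp P p) → p.IsChain (Tight cost pot)) := by
  induction p generalizing v with
  | nil => simp at hv
  | cons y p ih =>
    obtain rfl : y = v := by simpa using hv
    cases p with
    | nil =>
      obtain rfl : y = w := by simpa using hw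
      simp [chainExp]
    | cons z p =>
      rw [List.isChain_cons_cons] at hp
      rw [List.getLast?_cons_cons] at hw
      obtain ⟨h1, h2⟩ := ih hp.2 rfl hw
      obtain ⟨x, hx⟩ := hp.1
      have h3 := hfeas x y z hx
      rw [chainExp_cons (w := z) rfl, map_add, weight_edgeExp cost hx, ← add_assoc]
      refine ⟨h1.trans (by gcongr), fun he => ?_⟩
      have h4 : pot z = pot y + cost x := by
        refine le_antisymm h3 ?_
        have := he ▸ h1
        exact le_of_add_le_add_right this
      exact List.isChain_cons_cons.2 ⟨⟨x, hx, h4⟩, h2 (by rw [he, h4])⟩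

lemma pot_eq_of_tight_chain {Γ : Type*} [AddCommGroup Γ] {cost : Var P → Γ}
    {pot : Vertex P → Γ} {p : List (Vertex P)} {v w : Vertex P}
    (hp : p.IsChain (Tight cost pot)) (hv : p.head? = some v) (hw : p.getLast? = some w) :
    pot w = pot v + weight cost (chainExp P p) := by
  induction p generalizing v with
  | nil => simp at hv
  | cons y p ih =>
    obtain rfl : y = v := by simpa using hv
    cases p with
    | nil =>
      obtain rfl : y = w := by simpa using hw
      simp [chainExp]
    | cons z p =>
      rw [List.isChain_cons_cons] at hp
      rw [List.getLast?_cons_cons] at hw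
      obtain ⟨x, hx, h⟩ := hp.1
      rw [chainExp_cons (w := z) rfl, map_add, weight_edgeExp cost hx, ← add_assoc, ← h]
      exact ih hp.2 rfl hw

end Potential

/-! ### The duality argument -/

section Unique

variable {s : ℕ} {𝔄 : Fin s → ℕ}

lemma standardChain_isAugChain (hedge : ∀ r, (component P 𝔄 r).IsChain (AugEdge P))
    (x : Idx P 𝔄) :
    IsAugChain P (standardChain P 𝔄 x) (x.2 + 1) (initVert P 𝔄 x) (vert P 𝔄 x) := by
  obtain ⟨r, j, hj⟩ := x
  refine ⟨(hedge r).take _, ?_, ?_, ?_⟩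
  · simp only [standardChain, List.length_take]
    exact min_eq_left hj
  · simp only [standardChain, initVert, List.head?_take]
    rw [if_neg (by omega), List.head?_eq_getElem?, List.getElem?_eq_getElem (by omega)]
    rfl
  · simp only [standardChain, vert, List.getLast?_take]
    rw [if_neg (by omega), Nat.add_sub_cancel, List.getElem?_eq_getElem hj]
    rfl

/-- A tight chain that starts at an initial vertex can be traced back from its end: it is an
initial portion of a component chain. -/
lemma eq_take_of_tight {T : Vertex P → Vertex P → Prop}
    (hchain : ∀ r, (component P 𝔄 r).IsChain T)
    (huniq : ∀ r, ∀ w ∈ component P 𝔄 r, ∀ v v', T v w → T v' w → v = v')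
    (hinit : ∀ (x : Idx P 𝔄) v, ¬ T v (initVert P 𝔄 x))
    (x : Idx P 𝔄) (r : Fin s) (j : ℕ) (hj : j < (component P 𝔄 r).length)
    (p : List (Vertex P)) (hp : p.IsChain T) (hhead : p.head? = some (initVert P 𝔄 x))
    (hlast : p.getLast? = some (component P 𝔄 r)[j]) :
    p = (component P 𝔄 r).take (j + 1) := by
  induction j generalizing p with
  | zero =>
    rcases List.eq_nil_or_concat p with rfl | ⟨q, w, rfl⟩
    · simp at hhead
    rw [List.concat_eq_append] at *
    obtain rfl : w = (component P 𝔄 r)[0] := by simpa using hlast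
    rcases List.eq_nil_or_concat q with rfl | ⟨q', v, rfl⟩
    · rw [List.take_one, List.head?_eq_getElem?, List.getElem?_eq_getElem hj]; rfl
    · rw [List.concat_eq_append, List.isChain_append] at hp
      exact absurd (hp.2.2 v (by simp) _ rfl) (hinit ⟨r, 0, hj⟩ v)
  | succ j ih =>
    rcases List.eq_nil_or_concat p with rfl | ⟨q, w, rfl⟩
    · simp at hhead
    rw [List.concat_eq_append] at *
    obtain rfl : w = (component P 𝔄 r)[j + 1] := by simpa using hlast
    have hT := List.isChain_iff_getElem.1 (hchain r) j hj
    rcases List.eq_nil_or_concat q with rfl | ⟨q', v, rfl⟩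
    · -- the initial vertex has no tight predecessor, but `(component P 𝔄 r)[j + 1]` has one
      have : (component P 𝔄 r)[j + 1] = initVert P 𝔄 x := by simpa using hhead
      exact absurd (this ▸ hT) (hinit x _)
    · rw [List.concat_eq_append] at *
      rw [List.isChain_append] at hp
      have hv : v = (component P 𝔄 r)[j] :=
        huniq r _ (List.getElem_mem hj) _ _ (hp.2.2 v (by simp) _ (by simp)) hT
      rw [ih (by omega) (q' ++ [v]) hp.1 (by simpa using hhead) (by simp [hv]),
        List.take_succ_eq_append_getElem hj]

/-- The duality argument. Suppose that a potential increases along each edge by at most the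
weight of its variable, that the component chains are tight, that each of their vertices has at
most one tight predecessor and that the initial vertices have none. Summing over the chains of a
factorization of `± μ_𝔄` shows that all of its chains are tight, which determines them. -/
lemma eq_standardTriple_of_potential {Γ : Type*} [AddCommGroup Γ] [LinearOrder Γ]
    [IsOrderedAddMonoid Γ] {cost : Var P → Γ} {pot : Vertex P → Γ}
    (hfeas : ∀ x v w, Step P x v w → pot w ≤ pot v + cost x)
    (hchain : ∀ r, (component P 𝔄 r).IsChain (Tight cost pot))
    (huniq : ∀ r, ∀ w ∈ component P 𝔄 r, ∀ v v',
      Tight cost pot v w → Tight cost pot v' w → v = v')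
    (hinit : ∀ (x : Idx P 𝔄) v, ¬ Tight cost pot v (initVert P 𝔄 x))
    (hinj : ∀ x y : Idx P 𝔄, initVert P 𝔄 x = initVert P 𝔄 y → x.1 = y.1)
    {f : Triple P 𝔄} (hf : IsChainFactorization P 𝔄 f (distinguishedExp P 𝔄)) :
    f = standardTriple P 𝔄 := by
  have hedge : ∀ r, (component P 𝔄 r).IsChain (AugEdge P) := fun r =>
    (hchain r).imp fun _ _ ⟨x, hx, _⟩ => ⟨x, hx⟩
  have hstd : ∀ x, pot (vert P 𝔄 x) =
      pot (initVert P 𝔄 x) + weight cost (chainExp P (standardChain P 𝔄 x)) := fun x =>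
    have h := standardChain_isAugChain hedge x
    pot_eq_of_tight_chain ((hchain x.1).take _) h.2.2.1 h.2.2.2
  have hle := fun x => pot_le_of_chain hfeas (hf.isAugChain x).1 (hf.isAugChain x).2.2.1
    (hf.isAugChain x).2.2.2
  have hsum : ∑ x, pot (vert P 𝔄 (f.perm x)) =
      ∑ x, (pot (initVert P 𝔄 x) + weight cost (chainExp P (f.chain x))) := by
    rw [Equiv.sum_comp f.perm fun x => pot (vert P 𝔄 x), Finset.sum_congr rfl fun x _ => hstd x,
      Finset.sum_add_distrib, Finset.sum_add_distrib, ← map_sum, ← map_sum,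
      Finset.sum_congr rfl fun x _ => (hf.mono_eq x).symm, hf.prod_eq]
    rfl
  have heq := (Finset.sum_eq_sum_iff_of_le fun x _ => (hle x).1).1 hsum
  have htake : ∀ x, f.chain x = standardChain P 𝔄 (f.perm x) := fun x =>
    eq_take_of_tight hchain huniq hinit x (f.perm x).1 (f.perm x).2 (f.perm x).2.2 _
      ((hle x).2 (heq x (Finset.mem_univ x))) (hf.isAugChain x).2.2.1 (hf.isAugChain x).2.2.2
  have hperm : ∀ x, f.perm x = x := by
    intro x
    have h := standardChain_isAugChain hedge (f.perm x)
    have h' := hf.isAugChain x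
    rw [htake] at h'
    have h1 : (f.perm x).1 = x.1 := hinj _ _ (Option.some.inj (h.2.2.1.symm.trans h'.2.2.1))
    have h2 : ((f.perm x).2 : ℕ) = x.2 := by
      have := h.2.1.symm.trans h'.2.1
      omega
    generalize f.perm x = y at h1 h2
    obtain ⟨r, j⟩ := x
    obtain ⟨r', j'⟩ := y
    obtain rfl : r' = r := h1
    exact congrArg _ (Fin.ext h2)
  have hchain_eq : ∀ x, f.chain x = standardChain P 𝔄 x := fun x => by rw [htake, hperm]
  ext1
  · funext x
    rw [hf.mono_eq, hchain_eq]; rfl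
  · exact Equiv.ext hperm
  · exact funext hchain_eq

end Unique

/-! ### The potential -/

/-- `y ^ 2 - (y - m) ^ 2`, with the subtraction `y - m` truncated. -/
def sqDrop (m y : ℕ) : ℤ := (y : ℤ) ^ 2 - ((y - m : ℕ) : ℤ) ^ 2

lemma sqDrop_zero_right (m : ℕ) : sqDrop m 0 = 0 := by simp [sqDrop]

lemma sqDrop_zero_left (y : ℕ) : sqDrop 0 y = 0 := by simp [sqDrop]

lemma sqDrop_lt_sqDrop {m y y' : ℕ} (hm : 1 ≤ m) (h : y < y') : sqDrop m y < sqDrop m y' := by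
  refine strictMono_nat_of_lt_succ (f := sqDrop m) (fun k => ?_) h
  simp only [sqDrop]
  rcases Nat.lt_or_ge k m with hk | hk
  · rw [show k - m = 0 by omega, show k + 1 - m = 0 by omega]
    push_cast; nlinarith
  · rw [show k + 1 - m = (k - m) + 1 by omega]
    obtain ⟨c, rfl⟩ := Nat.exists_eq_add_of_le hk
    rw [Nat.add_sub_cancel_left]
    push_cast; nlinarith

lemma sqDrop_le_sqDrop (m : ℕ) {y y' : ℕ} (h : y ≤ y') : sqDrop m y ≤ sqDrop m y' := by
  rcases Nat.eq_zero_or_pos m with rfl | hm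
  · simp [sqDrop_zero_left]
  · rcases h.eq_or_lt with rfl | h
    · exact le_rfl
    · exact (sqDrop_lt_sqDrop hm h).le

/-- The first component of the potential of a vertex `(u, ℓ, k)`. It is twice the displacement
`u - 2` from the initial position of the inner chain, except on the left border `u = 1`, on the
levels up to `b`, where moving is free, and on the right border `u = ℓ`. There it is smaller by
`1`, so that the right border is reached most cheaply by passing through the level `b`. -/
def potMain (b u ℓ : ℕ) : ℤ :=
  if ℓ ≤ b then 0 else if u = 1 then 0 else if u = ℓ then 2 * ℓ - 5 else 2 * (u - 2)

/-- The second component of the potential on the right border `u = ℓ`, up to the constant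
`1 - b`. -/
def borderFine (P : n.Partition) (a b ℓ : ℕ) : ℤ :=
  ((ℓ - a : ℕ) : ℤ) ^ 2 + min (ℓ : ℤ) a - b - if a ≤ ℓ ∧ a - 1 ∈ levels P then 1 else 0

/-- The second component of the potential of a vertex `(u, ℓ, k)`. It breaks the ties of the
first one: among the paths through the level `b` those with the longest stay on the levels `b` and
`b - 1` are cheapest, and above the level `a` ascents cost more at higher levels, by the strict
convexity of the square. -/
def potFine (P : n.Partition) (a b u ℓ : ℕ) : ℤ :=
  if ℓ ≤ b then 1 - u else if u = 1 then 0 else if u = ℓ then borderFine P a b ℓ - b + 1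
    else sqDrop (u - 2) (ℓ - a)

/-- The first component of the weight of a variable. An ascent costs twice its displacement; the
extra `2 * b - 5` for leaving the level `b` makes a passage through `b` that ends on the right
border of a level `ℓ` cost `2 * ℓ - 5` in total. The value `3` for `z_ℓ` with `ℓ ≠ a, b`, and the
value `1` for `s_i`, `t_i` with `i⁻` below the levels `b` and `b - 1`, exclude these variables from
tight edges. -/
def costMain (P : n.Partition) (a b : ℕ) : Var P → ℤ
  | .s i => if (i : ℕ) ≤ b ∧ ¬ ((i : ℕ) = b ∧ b - 1 ∈ levels P) then 1 else 0
  | .t i => if b < (i : ℕ) then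
        2 * ((i : ℕ) - prevLevel P i) + if prevLevel P i = b then 2 * (b : ℤ) - 5 else 0
      else if (i : ℕ) = b ∧ b - 1 ∈ levels P then 0 else 1
  | .e _ _ => 0
  | .z ℓ => if (ℓ : ℕ) = b then 0 else if (ℓ : ℕ) = a then 2 else 3

/-- The second component of the weight of a variable. For `t_i` with `i > b` it is chosen to make
the right border tight; it vanishes for `t_a` when `a - 1` is a part. -/
def costFine (P : n.Partition) (a b : ℕ) : Var P → ℤ
  | .s _ => 0
  | .t i => if b < (i : ℕ) then borderFine P a b i - borderFine P a b (prevLevel P i)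
      else if (i : ℕ) = b ∧ b - 1 ∈ levels P then -1 else 0
  | .e _ _ => 0
  | .z ℓ => if (ℓ : ℕ) = b then -1 else 0

/-- The potential, with values in the lexicographically ordered group of pairs of integers. -/
def pot (P : n.Partition) (a b : ℕ) (v : Vertex P) : ℤ ×ₗ ℤ :=
  toLex (potMain b v.pos v.level, potFine P a b v.pos v.level)

/-- The weights of the variables for the potential `pot`. -/
def cost (P : n.Partition) (a b : ℕ) (x : Var P) : ℤ ×ₗ ℤ :=
  toLex (costMain P a b x, costFine P a b x)

lemma potMain_low {b u ℓ : ℕ} (h : ℓ ≤ b) : potMain b u ℓ = 0 := if_pos h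

lemma potFine_low {a b u ℓ : ℕ} (h : ℓ ≤ b) : potFine P a b u ℓ = 1 - u := if_pos h

lemma potMain_one (b ℓ : ℕ) : potMain b 1 ℓ = 0 := by
  simp only [potMain, if_true, ite_self]

lemma potFine_one (a b ℓ : ℕ) : potFine P a b 1 ℓ = 0 := by
  simp [potFine]

lemma potMain_border {b ℓ : ℕ} (h : b < ℓ) (h1 : ℓ ≠ 1) : potMain b ℓ ℓ = 2 * ℓ - 5 := by
  rw [potMain, if_neg (by omega), if_neg h1, if_pos rfl]

lemma potFine_border {a b ℓ : ℕ} (h : b < ℓ) (h1 : ℓ ≠ 1) :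
    potFine P a b ℓ ℓ = borderFine P a b ℓ - b + 1 := by
  rw [potFine, if_neg (by omega), if_neg h1, if_pos rfl]

lemma potMain_inner {b u ℓ : ℕ} (h : b < ℓ) (h1 : u ≠ 1) (h2 : u ≠ ℓ) :
    potMain b u ℓ = 2 * (u - 2) := by
  rw [potMain, if_neg (by omega), if_neg h1, if_neg h2]

lemma potFine_inner {a b u ℓ : ℕ} (h : b < ℓ) (h1 : u ≠ 1) (h2 : u ≠ ℓ) :
    potFine P a b u ℓ = sqDrop (u - 2) (ℓ - a) := by
  rw [potFine, if_neg (by omega), if_neg h1, if_neg h2]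

/-- The pair `(m₁, f₁)` is lexicographically at most `(m₂, f₂)`, with equality exactly under the
condition `C`. -/
def LexLe (m₁ f₁ m₂ f₂ : ℤ) (C : Prop) : Prop :=
  (m₁ < m₂ ∨ m₁ = m₂ ∧ f₁ ≤ f₂) ∧ (m₁ = m₂ ∧ f₁ = f₂ ↔ C)

section Edges

variable {a b : ℕ} {m₁ f₁ m₂ f₂ : ℤ} {C : Prop}

lemma LexLe.of_lt (h : m₁ < m₂) (hC : ¬ C) : LexLe m₁ f₁ m₂ f₂ C :=
  ⟨.inl h, fun h' => absurd h'.1 h.ne, fun h' => absurd h' hC⟩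

lemma LexLe.of_eq_of_lt (hm : m₁ = m₂) (h : f₁ < f₂) (hC : ¬ C) : LexLe m₁ f₁ m₂ f₂ C :=
  ⟨.inr ⟨hm, h.le⟩, fun h' => absurd h'.2 h.ne, fun h' => absurd h' hC⟩

lemma LexLe.of_eq (hm : m₁ = m₂) (h : f₁ = f₂) (hC : C) : LexLe m₁ f₁ m₂ f₂ C :=
  ⟨.inr ⟨hm, h.le⟩, fun _ => hC, fun _ => ⟨hm, h⟩⟩

lemma borderFine_sub_of_le {p i : ℕ} (hp : a ≤ p) (hi : a ≤ i) :
    borderFine P a b i - borderFine P a b p =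
      ((i - a : ℕ) : ℤ) ^ 2 - ((p - a : ℕ) : ℤ) ^ 2 := by
  simp only [borderFine, hp, hi, true_and]
  rw [min_eq_right (by exact_mod_cast hi), min_eq_right (by exact_mod_cast hp)]
  ring

lemma borderFine_sub_of_ge {p i : ℕ} (hp : p < a) (hi : i ≤ a) :
    borderFine P a b i - borderFine P a b p =
      i - p - if i = a ∧ a - 1 ∈ levels P then 1 else 0 := by
  simp only [borderFine]
  rw [show i - a = 0 by omega, show p - a = 0 by omega,
    min_eq_left (by exact_mod_cast hi), min_eq_left (by exact_mod_cast hp.le),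
    if_neg (by omega : ¬ (a ≤ p ∧ a - 1 ∈ levels P))]
  have : a ≤ i ↔ i = a := by omega
  simp only [this]
  push_cast; ring

/-- Along an edge of `β_i` the potential does not increase. The last condition describes the
target `(u, i⁻, 1)` of the tight edges. -/
lemma pot_step_s (hab : b + 2 ≤ a) (hb : 1 ≤ b) (ha : a ∈ levels P) (hbS : b ∈ levels P)
    (i : {i // i ∈ upperLevels P}) {u : ℕ} (hu : 1 ≤ u) (hup : u ≤ prevLevel P i) :
    LexLe (potMain b u (prevLevel P i)) (potFine P a b u (prevLevel P i))
      (potMain b u i + costMain P a b (.s i)) (potFine P a b u i + costFine P a b (.s i))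
      ((b < prevLevel P i ∧ u < prevLevel P i ∧ (u ≤ 2 ∨ prevLevel P i < a)) ∨
        (prevLevel P i = b ∧ u = 1) ∨ prevLevel P i + 1 = b) := by
  obtain ⟨i, hi⟩ := i
  obtain ⟨hiS, hpS, hpi, hmax⟩ := prevLevel_facts hi
  have hbm := hmax b hbS
  have ham := hmax a ha
  have hbm1 := hmax (b - 1)
  simp only [costMain, costFine]
  generalize prevLevel P i = p at *
  rcases Nat.lt_or_ge b i with hbi | hbi
  · rw [if_neg (by omega)]
    have hbp := hbm hbi
    rcases Nat.eq_or_lt_of_le hu with rfl | hu1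
    · rw [potMain_one, potFine_one, potMain_one, potFine_one]
      exact .of_eq (by omega) (by omega) (by omega)
    rw [potMain_inner hbi (by omega) (by omega), potFine_inner hbi (by omega) (by omega)]
    rcases Nat.eq_or_lt_of_le hbp with hbp | hbp
    · rw [potMain_low hbp.ge, potFine_low hbp.ge]
      have h0 := sqDrop_le_sqDrop (u - 2) (Nat.zero_le (i - a))
      rw [sqDrop_zero_right] at h0
      by_cases hu2 : u = 2
      · exact .of_eq_of_lt (by omega) (by omega) (by omega)
      · exact .of_lt (by omega) (by omega)
    · rcases Nat.eq_or_lt_of_le hup with rfl | hup'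
      · rw [potMain_border hbp (by omega)]
        exact .of_lt (by omega) (by omega)
      · rw [potMain_inner hbp (by omega) (by omega), potFine_inner hbp (by omega) (by omega)]
        by_cases hC : u ≤ 2 ∨ p < a
        · have h0 : sqDrop (u - 2) (p - a) = sqDrop (u - 2) (i - a) := by
            by_cases hu2 : u = 2
            · rw [hu2, Nat.sub_self, sqDrop_zero_left, sqDrop_zero_left]
            · rw [show p - a = i - a by omega]
          exact .of_eq (by omega) (by omega) (.inl ⟨hbp, hup', hC⟩)
        · have h0 := sqDrop_lt_sqDrop (show 1 ≤ u - 2 by omega) (show p - a < i - a by omega)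
          exact .of_eq_of_lt (by omega) (by omega) (by omega)
  · rw [potMain_low hbi, potFine_low hbi, potMain_low (by omega), potFine_low (by omega)]
    by_cases h : i = b ∧ b - 1 ∈ levels P
    · have := hbm1 h.2 (by omega)
      rw [if_neg (by tauto)]
      exact .of_eq (by omega) (by omega) (by omega)
    · rw [if_pos ⟨hbi, h⟩]
      refine .of_lt (by omega) fun hC => h ⟨by omega, ?_⟩
      rw [show b - 1 = p by omega]
      exact hpS

/-- Along an edge of `α_i` the potential increases by at most the weight of `t_i`. The last
condition describes the tight edges, from `(u, i⁻, n_{i⁻})` to `(u', i, 1)`. -/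
lemma pot_step_t (hab : b + 2 ≤ a) (hb : 1 ≤ b) (ha : a ∈ levels P) (hbS : b ∈ levels P)
    (i : {i // i ∈ upperLevels P}) {u u' : ℕ} (hu : 1 ≤ u) (hup : u ≤ prevLevel P i)
    (hu' : u' + prevLevel P i = u + i) :
    LexLe (potMain b u' i) (potFine P a b u' i)
      (potMain b u (prevLevel P i) + costMain P a b (.t i))
      (potFine P a b u (prevLevel P i) + costFine P a b (.t i))
      ((b < (i : ℕ) ∧ u' = i) ∨ (2 ≤ u ∧ a < (i : ℕ)) ∨
        (2 ≤ u ∧ (i : ℕ) = a ∧ a - 1 ∈ levels P) ∨ ((i : ℕ) = b ∧ b - 1 ∈ levels P)) := by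
  obtain ⟨i, hi⟩ := i
  obtain ⟨hiS, hpS, hpi, hmax⟩ := prevLevel_facts hi
  have hbm := hmax b hbS
  have ham := hmax a ha
  have hbm1 := hmax (b - 1)
  have ham1 := hmax (a - 1)
  simp only [costMain, costFine] at *
  generalize prevLevel P i = p at *
  rcases Nat.lt_or_ge b i with hbi | hbi
  · simp only [if_pos hbi]
    have hbp := hbm hbi
    rcases Nat.eq_or_lt_of_le hup with rfl | hup'
    · -- along the right border
      obtain rfl : u' = i := by omega
      rw [potMain_border hbi (by omega), potFine_border hbi (by omega)]
      have hC : b < u' ∧ u' = u' := ⟨hbi, rfl⟩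
      rcases Nat.eq_or_lt_of_le hbp with rfl | hbp
      · rw [potMain_low le_rfl, potFine_low le_rfl, if_pos rfl]
        have : borderFine P a b b = 0 := by
          simp only [borderFine]
          rw [show b - a = 0 by omega, if_neg (by omega), min_eq_left (by omega)]
          simp
        exact .of_eq (by omega) (by omega) (.inl hC)
      · rw [potMain_border hbp (by omega), potFine_border hbp (by omega), if_neg (by omega)]
        exact .of_eq (by omega) (by omega) (.inl hC)
    · rw [potMain_inner hbi (by omega) (by omega), potFine_inner hbi (by omega) (by omega)]
      rcases Nat.eq_or_lt_of_le hbp with rfl | hbp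
      · rw [potMain_low le_rfl, if_pos rfl]
        refine .of_lt (by omega) ?_
        rintro (h | h | ⟨-, h, h'⟩ | h)
        · omega
        · omega
        · have := ham1 h'; omega
        · omega
      rw [if_neg (by omega)]
      rcases Nat.eq_or_lt_of_le hu with rfl | hu1
      · rw [potMain_one]
        exact .of_lt (by omega) (by omega)
      rw [potMain_inner hbp (by omega) (by omega), potFine_inner hbp (by omega) (by omega)]
      rcases Nat.lt_or_ge a i with hai | hai
      · have hap := ham hai
        rw [borderFine_sub_of_le hap hai.le]
        simp only [sqDrop]
        rw [show i - a - (u' - 2) = p - a - (u - 2) by omega]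
        exact .of_eq (by omega) (by omega) (by omega)
      · rw [borderFine_sub_of_ge (by omega) hai, show i - a = 0 by omega,
          show p - a = 0 by omega, sqDrop_zero_right, sqDrop_zero_right]
        split_ifs with h
        · have := ham1 h.2 (by omega)
          exact .of_eq (by omega) (by omega)
            (.inr (.inr (.inl ⟨hu1, h⟩)))
        · refine .of_eq_of_lt (by omega) (by omega) ?_
          rintro (h' | h' | ⟨-, h'⟩ | h')
          · omega
          · omega
          · exact h h'
          · omega
  · simp only [if_neg (show ¬ b < i by omega)]
    rw [potMain_low hbi, potFine_low hbi, potMain_low (by omega), potFine_low (by omega)]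
    by_cases h : i = b ∧ b - 1 ∈ levels P
    · have := hbm1 h.2 (by omega)
      rw [if_pos h, if_pos h]
      exact .of_eq (by omega) (by omega) (.inr (.inr (.inr h)))
    · rw [if_neg h, if_neg h]
      refine .of_lt (by omega) ?_
      rintro (h' | h' | h' | h')
      · omega
      · omega
      · omega
      · exact h h'

/-- Along an edge of `w_ℓ` the potential increases by at most the weight of `z_ℓ`. The last
condition describes the target `(u + 1, ℓ, 1)` of the tight edges. -/
lemma pot_step_z (hab : b + 2 ≤ a) (ℓ : {ℓ // ℓ ∈ oddMinima P}) {u : ℕ}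
    (hu : 1 ≤ u) (hul : u + 1 ≤ ℓ) :
    LexLe (potMain b (u + 1) ℓ) (potFine P a b (u + 1) ℓ)
      (potMain b u ℓ + costMain P a b (.z ℓ)) (potFine P a b u ℓ + costFine P a b (.z ℓ))
      ((ℓ : ℕ) - 1 ∉ levels P ∧
        ((ℓ : ℕ) = b ∨ ((ℓ : ℕ) = a ∧ 3 ≤ u + 1 ∧ u + 1 < a))) := by
  obtain ⟨ℓ, hℓ⟩ := ℓ
  have hodd : ℓ - 1 ∉ levels P := by
    obtain ⟨-, m, -, hm, -⟩ := Finset.mem_filter.1 hℓ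
    exact hm.2.2.1
  simp only [costMain, costFine] at *
  rcases Nat.lt_or_ge b ℓ with hbl | hbl
  · rw [if_neg (show ¬ ℓ = b by omega), if_neg (show ¬ ℓ = b by omega)]
    have hc : (2 : ℤ) ≤ if ℓ = a then 2 else 3 := by split_ifs <;> omega
    rcases Nat.eq_or_lt_of_le hul with h | h
    · rw [h, potMain_border hbl (by omega)]
      refine .of_lt ?_ (by omega)
      rcases Nat.eq_or_lt_of_le hu with rfl | hu1
      · rw [potMain_one]; omega
      · rw [potMain_inner hbl (by omega) (by omega)]; omega
    · rw [potMain_inner hbl (by omega) (by omega), potFine_inner hbl (by omega) (by omega)]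
      rcases Nat.eq_or_lt_of_le hu with rfl | hu1
      · rw [potMain_one]
        exact .of_lt (by omega) (by omega)
      rw [potMain_inner hbl (by omega) (by omega), potFine_inner hbl (by omega) (by omega)]
      by_cases hla : ℓ = a
      · rw [if_pos hla, show ℓ - a = 0 by omega, sqDrop_zero_right, sqDrop_zero_right]
        exact .of_eq (by omega) (by omega) ⟨hodd, by omega⟩
      · rw [if_neg hla]
        exact .of_lt (by omega) (by omega)
  · rw [potMain_low hbl, potFine_low hbl, potMain_low hbl, potFine_low hbl]
    by_cases hlb : ℓ = b
    · rw [if_pos hlb, if_pos hlb]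
      exact .of_eq (by omega) (by omega) ⟨hodd, .inl hlb⟩
    · rw [if_neg hlb, if_neg hlb]
      refine .of_lt ?_ (by omega)
      split_ifs <;> omega

end Edges

/-! ### Tight edges -/

lemma Vertex.bounds (v : Vertex P) : v.level ∈ levels P ∧ 1 ≤ v.pos ∧ v.pos ≤ v.level ∧
    1 ≤ v.height ∧ v.height ≤ mult P v.level := by
  obtain ⟨⟨u, i, k⟩, hv⟩ := v
  simp only [vertices, Finset.mem_biUnion, Finset.mem_product, Finset.mem_Icc,
    Finset.mem_singleton] at hv
  obtain ⟨j, hj, hu, rfl, hk⟩ := hv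
  exact ⟨hj, hu.1, hu.2, hk.1, hk.2⟩

lemma Vertex.ext {v w : Vertex P} (h1 : v.pos = w.pos) (h2 : v.level = w.level)
    (h3 : v.height = w.height) : v = w :=
  Subtype.ext (Prod.ext h1 (Prod.ext h2 h3))

lemma eq_prevLevel {i j : ℕ} (hi : i ∈ levels P) (hj : j ∈ levels P) (hij : i < j)
    (h : ∀ k ∈ levels P, i < k → j ≤ k) : j ∈ upperLevels P ∧ prevLevel P j = i := by
  have hu : j ∈ upperLevels P := Finset.mem_filter.2 ⟨hj, i, hi, hij⟩
  obtain ⟨-, h1, h2, h3⟩ := prevLevel_facts hu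
  refine ⟨hu, le_antisymm ?_ (h3 i hi hij)⟩
  by_contra hlt
  have := h _ h1 (not_le.1 hlt)
  omega

lemma prevLevel_injOn {i j : ℕ} (hi : i ∈ upperLevels P) (hj : j ∈ upperLevels P)
    (h : prevLevel P i = prevLevel P j) : i = j := by
  obtain ⟨hi1, -, hi2, hi3⟩ := prevLevel_facts hi
  obtain ⟨hj1, -, hj2, hj3⟩ := prevLevel_facts hj
  by_contra hne
  rcases Nat.lt_or_gt_of_ne hne with hlt | hlt
  · have := hj3 i hi1 hlt; omega
  · have := hi3 j hj1 hlt; omega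

lemma toLex_le_iff_lexLe {m₁ f₁ m₂ f₂ m₃ f₃ : ℤ} {C : Prop}
    (h : LexLe m₁ f₁ (m₂ + m₃) (f₂ + f₃) C) :
    (toLex (m₁, f₁) : ℤ ×ₗ ℤ) ≤ toLex (m₂, f₂) + toLex (m₃, f₃) ∧
      ((toLex (m₁, f₁) : ℤ ×ₗ ℤ) = toLex (m₂, f₂) + toLex (m₃, f₃) ↔ C) := by
  rw [← toLex_add, Prod.mk_add_mk, Prod.Lex.toLex_le_toLex, toLex_inj, Prod.mk.injEq]
  exact h

section Tight

variable {a b : ℕ} {v w : Vertex P}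

lemma one_le_of_mem_levels {i : ℕ} (hi : i ∈ levels P) : 1 ≤ i :=
  P.parts_pos (Multiset.mem_toFinset.1 hi)

lemma pot_s (hab : b + 2 ≤ a) (ha : a ∈ levels P) (hbS : b ∈ levels P)
    {i : {i // i ∈ upperLevels P}} (h : Step P (.s i) v w) :
    pot P a b w ≤ pot P a b v + cost P a b (.s i) ∧
      (pot P a b w = pot P a b v + cost P a b (.s i) ↔
        (b < w.level ∧ w.pos < w.level ∧ (w.pos ≤ 2 ∨ w.level < a)) ∨
        (w.level = b ∧ w.pos = 1) ∨ w.level + 1 = b) := by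
  obtain ⟨h1, -, h3, -, h5⟩ := h
  obtain ⟨-, hw1, hw2, -⟩ := w.bounds
  simp only [pot, cost, ← h5, h1]
  rw [h3] at hw2 ⊢
  exact toLex_le_iff_lexLe
    (pot_step_s hab (one_le_of_mem_levels hbS) ha hbS i hw1 hw2)

lemma pot_t (hab : b + 2 ≤ a) (ha : a ∈ levels P) (hbS : b ∈ levels P)
    {i : {i // i ∈ upperLevels P}} (h : Step P (.t i) v w) :
    pot P a b w ≤ pot P a b v + cost P a b (.t i) ∧
      (pot P a b w = pot P a b v + cost P a b (.t i) ↔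
        (b < w.level ∧ w.pos = w.level) ∨ (2 ≤ v.pos ∧ a < w.level) ∨
        (2 ≤ v.pos ∧ w.level = a ∧ a - 1 ∈ levels P) ∨
        (w.level = b ∧ b - 1 ∈ levels P)) := by
  obtain ⟨h1, -, h3, -, h5⟩ := h
  obtain ⟨-, hv1, hv2, -⟩ := v.bounds
  simp only [pot, cost, h1, h3]
  rw [h1] at hv2
  exact toLex_le_iff_lexLe
    (pot_step_t hab (one_le_of_mem_levels hbS) ha hbS i hv1 hv2 h5)

lemma pot_z (hab : b + 2 ≤ a) {ℓ : {ℓ // ℓ ∈ oddMinima P}} (h : Step P (.z ℓ) v w) :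
    pot P a b w ≤ pot P a b v + cost P a b (.z ℓ) ∧
      (pot P a b w = pot P a b v + cost P a b (.z ℓ) ↔
        w.level - 1 ∉ levels P ∧
        (w.level = b ∨ (w.level = a ∧ 3 ≤ w.pos ∧ w.pos < a))) := by
  obtain ⟨h1, -, h3, -, h5⟩ := h
  obtain ⟨-, hv1, hv2, -⟩ := v.bounds
  obtain ⟨-, hw1, hw2, -⟩ := w.bounds
  simp only [pot, cost, h1, h3, h5]
  rw [h3, h5] at hw2
  exact toLex_le_iff_lexLe (pot_step_z hab ℓ hv1 hw2)

lemma pot_e {i : {i // i ∈ levels P}} {k : Fin (mult P i - 1)} (h : Step P (.e i k) v w) :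
    pot P a b w = pot P a b v + cost P a b (.e i k) := by
  obtain ⟨h1, -, h3, -, h5⟩ := h
  simp only [pot, cost, h1, h3, h5, costMain, costFine]
  rw [← toLex_add, Prod.mk_add_mk, add_zero, add_zero]

lemma pot_le_of_step (hab : b + 2 ≤ a) (ha : a ∈ levels P) (hbS : b ∈ levels P)
    (x : Var P) (v w : Vertex P) (h : Step P x v w) :
    pot P a b w ≤ pot P a b v + cost P a b x := by
  cases x with
  | s i => exact (pot_s hab ha hbS h).1
  | t i => exact (pot_t hab ha hbS h).1
  | e i k => exact (pot_e h).le
  | z ℓ => exact (pot_z hab h).1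

/-- The tight edges, sorted by the kind of their variable. -/
lemma tight_cases (hab : b + 2 ≤ a) (ha : a ∈ levels P) (hbS : b ∈ levels P)
    (hT : Tight (cost P a b) (pot P a b) v w) :
    (v.level = w.level ∧ v.pos = w.pos ∧ w.height = v.height + 1) ∨
    (w.height = 1 ∧ v.height = mult P v.level ∧ v.level ∈ upperLevels P ∧
      prevLevel P v.level = w.level ∧ w.level < v.level ∧ v.pos = w.pos ∧
      ((b < w.level ∧ w.pos < w.level ∧ (w.pos ≤ 2 ∨ w.level < a)) ∨
        (w.level = b ∧ w.pos = 1) ∨ w.level + 1 = b)) ∨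
    (w.height = 1 ∧ v.height = mult P v.level ∧ v.level = prevLevel P w.level ∧
      v.level < w.level ∧ w.pos + v.level = v.pos + w.level ∧
      ((b < w.level ∧ w.pos = w.level) ∨ (2 ≤ v.pos ∧ a < w.level) ∨
        (2 ≤ v.pos ∧ w.level = a ∧ a - 1 ∈ levels P) ∨
        (w.level = b ∧ b - 1 ∈ levels P))) ∨
    (w.height = 1 ∧ v.height = mult P v.level ∧ v.level = w.level ∧ w.pos = v.pos + 1 ∧
      w.level - 1 ∉ levels P ∧
        (w.level = b ∨ (w.level = a ∧ 3 ≤ w.pos ∧ w.pos < a))) := by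
  obtain ⟨x, hx, he⟩ := hT
  cases x with
  | s i =>
    rw [(pot_s hab ha hbS hx).2] at he
    obtain ⟨h1, h2, h3, h4, h5⟩ := hx
    have := prevLevel_facts i.2
    exact .inr (.inl ⟨h4, h1 ▸ h2, h1 ▸ i.2, by rw [h1, h3], by omega, h5.symm, he⟩)
  | t i =>
    rw [(pot_t hab ha hbS hx).2] at he
    obtain ⟨h1, h2, h3, h4, h5⟩ := hx
    have := prevLevel_facts i.2
    exact .inr (.inr (.inl ⟨h4, by rw [h1, h2], by rw [h1, h3], by omega, by omega, he⟩))
  | e i k =>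
    obtain ⟨h1, h2, h3, h4, h5⟩ := hx
    exact .inl ⟨by omega, by omega, by omega⟩
  | z ℓ =>
    rw [(pot_z hab hx).2] at he
    obtain ⟨h1, h2, h3, h4, h5⟩ := hx
    exact .inr (.inr (.inr ⟨h4, by rw [h1, h2], by omega, by omega, he⟩))

/-- The columns of the vertices of the two component chains of the pair `(a, b)`. -/
def OnUChain (a b u ℓ : ℕ) : Prop :=
  u = 1 ∨ (u = 2 ∧ a ≤ ℓ) ∨ ℓ = b ∨ ℓ + 1 = b ∨ (b < ℓ ∧ u = ℓ) ∨
    (ℓ = a ∧ 2 ≤ u ∧ u + 1 ≤ a) ∨ (ℓ + 1 = a ∧ 2 ≤ u ∧ u + 2 ≤ a) ∨ (a < ℓ ∧ u + 1 = ℓ)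

/-- The kind of a tight edge into a vertex of the component chains is determined by the position
and the level of that vertex. -/
lemma tight_pred_unique (hab : b + 2 ≤ a) (ha : a ∈ levels P) (hbS : b ∈ levels P)
    (hU : OnUChain a b w.pos w.level) {v' : Vertex P}
    (h : Tight (cost P a b) (pot P a b) v w) (h' : Tight (cost P a b) (pot P a b) v' w) :
    v = v' := by
  have hb := one_le_of_mem_levels hbS
  have bv := v.bounds
  have bv' := v'.bounds
  have bw := w.bounds
  -- ascending and horizontal edges into the same vertex are not both tight
  have haux : ((b < w.level ∧ w.pos = w.level) ∨ a < w.level ∨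
      (w.level = a ∧ a - 1 ∈ levels P) ∨ (w.level = b ∧ b - 1 ∈ levels P)) →
      w.level - 1 ∉ levels P → ¬ (w.level = b ∨ (w.level = a ∧ 3 ≤ w.pos ∧ w.pos < a)) := by
    rintro (h | h | ⟨h, hm⟩ | ⟨h, hm⟩) hn
    · omega
    · omega
    · exact absurd (h ▸ hm) hn
    · exact absurd (h ▸ hm) hn
  rw [OnUChain] at hU
  rcases tight_cases hab ha hbS h with h | h | h | h <;>
    rcases tight_cases hab ha hbS h' with h' | h' | h' | h'
  · exact Vertex.ext (by omega) (by omega) (by omega)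
  · omega
  · omega
  · omega
  · omega
  · have : v.level = v'.level := prevLevel_injOn h.2.2.1 h'.2.2.1 (by omega)
    exact Vertex.ext (by omega) this (by rw [h.2.1, h'.2.1, this])
  · omega
  · omega
  · omega
  · omega
  · have : v.level = v'.level := by omega
    exact Vertex.ext (by omega) this (by rw [h.2.1, h'.2.1, this])
  · exact absurd h'.2.2.2.2.2 (haux (h.2.2.2.2.2.imp id (.imp And.right (.imp And.right id))) h'.2.2.2.2.1)
  · omega
  · omega
  · exact absurd h.2.2.2.2.2 (haux (h'.2.2.2.2.2.imp id (.imp And.right (.imp And.right id))) h.2.2.2.2.1)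
  · have : v.level = v'.level := by omega
    exact Vertex.ext (by omega) this (by rw [h.2.1, h'.2.1, this])

end Tight

/-! ### Columns -/

lemma mem_column {u i : ℕ} {v : Vertex P} : v ∈ column P u i ↔ v.pos = u ∧ v.level = i := by
  unfold column
  split_ifs with h
  · simp only [List.mem_map, List.mem_finRange, true_and]
    constructor
    · rintro ⟨k, rfl⟩
      exact ⟨rfl, rfl⟩
    · rintro ⟨rfl, rfl⟩
      have hv := v.bounds
      exact ⟨⟨v.height - 1, by omega⟩,
        Vertex.ext rfl rfl (show v.height - 1 + 1 = v.height by omega)⟩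
  · simp only [List.not_mem_nil, false_iff]
    rintro ⟨rfl, rfl⟩
    have hv := v.bounds
    exact h ⟨hv.2.1, hv.2.2.1⟩

lemma column_getElem_height {u i j : ℕ} (hj : j < (column P u i).length) :
    ((column P u i)[j]).height = j + 1 := by
  unfold column at hj ⊢
  split_ifs at hj with h
  · simp [h, Vertex.height]
  · simp at hj

lemma column_ne_nil {u i : ℕ} (hi : i ∈ levels P) (h1 : 1 ≤ u) (h2 : u ≤ i) :
    column P u i ≠ [] ∧ (column P u i).length = mult P i := by
  have hpos : 0 < mult P i := Multiset.count_pos.2 (Multiset.mem_toFinset.1 hi)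
  have hlen : (column P u i).length = mult P i := by
    unfold column
    rw [dif_pos ⟨h1, h2⟩]
    simp
  exact ⟨fun h => by rw [h] at hlen; simp at hlen; omega, hlen⟩

lemma column_eq_nil {u i : ℕ} (hi : i ∉ levels P) : column P u i = [] := by
  refine List.eq_nil_iff_forall_not_mem.2 fun v hv => hi ?_
  rw [mem_column] at hv
  exact hv.2 ▸ v.bounds.1

lemma column_head {u i : ℕ} {v : Vertex P} (h : v ∈ (column P u i).head?) :
    v.pos = u ∧ v.level = i ∧ v.height = 1 := by
  have hm := mem_column.1 (List.mem_of_mem_head? h)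
  refine ⟨hm.1, hm.2, ?_⟩
  rw [List.head?_eq_getElem?, Option.mem_def, List.getElem?_eq_some_iff] at h
  obtain ⟨hlt, rfl⟩ := h
  exact column_getElem_height hlt

lemma column_getLast {u i : ℕ} {v : Vertex P} (h : v ∈ (column P u i).getLast?) :
    v.pos = u ∧ v.level = i ∧ v.height = mult P i := by
  have hm := mem_column.1 (List.mem_of_getLast? h)
  refine ⟨hm.1, hm.2, ?_⟩
  have hv := v.bounds
  have hlen := (column_ne_nil hv.1 hv.2.1 hv.2.2.1).2
  rw [hm.1, hm.2] at hlen
  rw [List.getLast?_eq_getElem?, Option.mem_def, List.getElem?_eq_some_iff] at h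
  obtain ⟨hlt, rfl⟩ := h
  rw [column_getElem_height hlt]
  omega

/-- The last vertex of the first column is related to the first vertex of the second one. -/
def ColumnRel (P : n.Partition) (T : Vertex P → Vertex P → Prop) (q q' : ℕ × ℕ) : Prop :=
  ∀ v w : Vertex P, v.pos = q.1 → v.level = q.2 → v.height = mult P q.2 →
    w.pos = q'.1 → w.level = q'.2 → w.height = 1 → T v w

lemma isChain_flatMap_column {T : Vertex P → Vertex P → Prop}
    (hT : ∀ v w : Vertex P, w.level = v.level → w.pos = v.pos → w.height = v.height + 1 → T v w)
    {Q : List (ℕ × ℕ)} (hQ : ∀ q ∈ Q, q.2 ∈ levels P ∧ 1 ≤ q.1 ∧ q.1 ≤ q.2)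
    (hchain : Q.IsChain (ColumnRel P T)) :
    (Q.flatMap fun q => column P q.1 q.2).IsChain T := by
  rw [List.flatMap_def, List.isChain_flatten, List.isChain_map]
  · constructor
    · intro l hl
      obtain ⟨q, -, rfl⟩ := List.mem_map.1 hl
      refine List.isChain_iff_getElem.2 fun j hj => ?_
      have h1 := mem_column.1 (List.getElem_mem (Nat.lt_of_succ_lt hj))
      have h2 := mem_column.1 (List.getElem_mem hj)
      exact hT _ _ (by rw [h1.2, h2.2]) (by rw [h1.1, h2.1])
        (by rw [column_getElem_height, column_getElem_height])
    · refine hchain.imp fun q q' h v hv w hw => ?_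
      obtain ⟨h1, h2, h3⟩ := column_getLast hv
      obtain ⟨h4, h5, h6⟩ := column_head hw
      exact h v w h1 h2 h3 h4 h5 h6
  · intro h
    obtain ⟨q, hq, he⟩ := List.mem_map.1 h
    obtain ⟨h1, h2, h3⟩ := hQ q hq
    exact (column_ne_nil h1 h2 h3).1 he

/-! ### The columns of a component chain -/

lemma flatMap_filter_of_nil {α β : Type*} (L : List α) (p : α → Prop) [DecidablePred p]
    (f : α → List β) (h : ∀ x ∈ L, ¬ p x → f x = []) :
    L.flatMap f = (L.filter (fun x => decide (p x))).flatMap f := by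
  induction L with
  | nil => rfl
  | cons x L ih =>
    have ih' := ih fun y hy => h y (List.mem_cons_of_mem x hy)
    by_cases hx : p x
    · rw [List.filter_cons_of_pos (by simpa using hx), List.flatMap_cons, List.flatMap_cons, ih']
    · rw [List.filter_cons_of_neg (by simpa using hx), List.flatMap_cons, ih',
        h x List.mem_cons_self hx, List.nil_append]

/-- The elements of `S_P` in `{c, …, c + m - 1}`, in increasing order. -/
def levelsFrom (P : n.Partition) (c m : ℕ) : List ℕ :=
  (List.range' c m).filter fun ℓ => decide (ℓ ∈ levels P)

lemma mem_levelsFrom {c m ℓ : ℕ} : ℓ ∈ levelsFrom P c m ↔ (c ≤ ℓ ∧ ℓ < c + m) ∧ ℓ ∈ levels P := by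
  simp [levelsFrom, List.mem_range'_1]

/-- `j` is the smallest element of `S_P` that is at least `i + 1`. -/
def NextLevel (P : n.Partition) (i j : ℕ) : Prop :=
  i < j ∧ j ∈ levels P ∧ ∀ k ∈ levels P, i < k → j ≤ k

lemma levelsFrom_head {c m j : ℕ} (h : j ∈ (levelsFrom P (c + 1) m).head?) :
    NextLevel P c j := by
  induction m generalizing c with
  | zero => simp [levelsFrom] at h
  | succ m ih =>
    rw [levelsFrom, List.range'_succ] at h
    by_cases hc : c + 1 ∈ levels P
    · rw [List.filter_cons_of_pos (by simpa using hc)] at h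
      obtain rfl : c + 1 = j := by simpa using h
      exact ⟨by omega, hc, fun k _ hk => hk⟩
    · rw [List.filter_cons_of_neg (by simpa using hc)] at h
      obtain ⟨h1, h2, h3⟩ := ih h
      refine ⟨by omega, h2, fun k hk hck => h3 k hk ?_⟩
      rcases Nat.eq_or_lt_of_le hck with rfl | h
      · exact absurd hk hc
      · exact h

lemma levelsFrom_isChain (c m : ℕ) :
    (levelsFrom P c m).IsChain fun i j => i ∈ levels P ∧ NextLevel P i j := by
  induction m generalizing c with
  | zero => simp [levelsFrom]
  | succ m ih =>
    rw [levelsFrom, List.range'_succ]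
    by_cases hc : c ∈ levels P
    · rw [List.filter_cons_of_pos (by simpa using hc), List.isChain_cons]
      exact ⟨fun y hy => ⟨hc, levelsFrom_head hy⟩, ih (c + 1)⟩
    · rw [List.filter_cons_of_neg (by simpa using hc)]
      exact ih (c + 1)

lemma levelsFrom_getLast {c m j k : ℕ} (h : j ∈ (levelsFrom P c m).getLast?)
    (hk : k ∈ levels P) (hkm : k < c + m) : k ≤ j := by
  induction m with
  | zero => simp [levelsFrom] at h
  | succ m ih =>
    rw [levelsFrom, List.range'_concat, List.filter_append] at h
    by_cases hc : c + m ∈ levels P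
    · rw [List.filter_cons_of_pos (by simpa using hc)] at h
      obtain rfl : c + m = j := by simpa using h
      omega
    · rw [List.filter_cons_of_neg (by simpa using hc), List.filter_nil, List.append_nil] at h
      refine ih h ?_
      have : k ≠ c + m := fun he => hc (he ▸ hk)
      omega

/-- The pairs `(u, ℓ)` that label the columns passed by `hookChain P r c` at the levels `c` and
`c - 1`. -/
def turnColumns (P : n.Partition) (r c : ℕ) : List (ℕ × ℕ) :=
  (List.range' r (c + 2 - 2 * r)).flatMap fun u =>
    (u, c) :: if u + r ≤ c ∧ c - 1 ∈ levels P then [(u, c - 1)] else []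

/-- The pairs `(u, ℓ)` that label the nonempty columns passed by `hookChain P r c`. -/
def hookColumns (P : n.Partition) (r c : ℕ) : List (ℕ × ℕ) :=
  ((levelsFrom P (c + 1) (n - c)).reverse.map fun ℓ => (r, ℓ)) ++ turnColumns P r c ++
    (levelsFrom P (c + 1) (n - c)).map fun ℓ => (ℓ + 1 - r, ℓ)

lemma hookChain_eq (r c : ℕ) :
    hookChain P r c = (hookColumns P r c).flatMap fun q => column P q.1 q.2 := by
  have h1 : ∀ f : ℕ → ℕ, ((List.range' (c + 1) (n - c)).flatMap fun ℓ => column P (f ℓ) ℓ) =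
      (levelsFrom P (c + 1) (n - c)).flatMap fun ℓ => column P (f ℓ) ℓ := fun f =>
    flatMap_filter_of_nil _ (fun ℓ => ℓ ∈ levels P) _ fun x _ hx => column_eq_nil hx
  have h2 : ((List.range' (c + 1) (n - c)).reverse.flatMap fun ℓ => column P r ℓ) =
      (levelsFrom P (c + 1) (n - c)).reverse.flatMap fun ℓ => column P r ℓ := by
    rw [flatMap_filter_of_nil _ (fun ℓ => ℓ ∈ levels P) _ fun x _ hx => column_eq_nil hx,
      levelsFrom, List.filter_reverse]
  rw [hookChain, h1 fun ℓ => ℓ + 1 - r, h2, hookColumns, turnColumns, List.flatMap_append,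
    List.flatMap_append, List.flatMap_map, List.flatMap_map, List.flatMap_assoc]
  congr 3
  funext u
  rw [List.flatMap_cons]
  congr 1
  by_cases hu : u + r ≤ c
  · by_cases hc : c - 1 ∈ levels P
    · simp [hu, hc]
    · simp [hu, hc, column_eq_nil hc]
  · simp [hu]

lemma mem_turnColumns {r c : ℕ} {q : ℕ × ℕ} (h : q ∈ turnColumns P r c) :
    (q.2 = c ∧ r ≤ q.1 ∧ q.1 + r ≤ c + 1) ∨
      (q.2 = c - 1 ∧ c - 1 ∈ levels P ∧ r ≤ q.1 ∧ q.1 + r ≤ c) := by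
  simp only [turnColumns, List.mem_flatMap, List.mem_range'_1, List.mem_cons] at h
  obtain ⟨u, hu, rfl | h⟩ := h
  · exact .inl ⟨rfl, hu.1, by simp only; omega⟩
  · split_ifs at h with hc
    · obtain rfl : q = (u, c - 1) := by simpa using h
      exact .inr ⟨rfl, hc.2, hu.1, hc.1⟩
    · simp at h

lemma mem_hookColumns {r c : ℕ} {q : ℕ × ℕ} (h : q ∈ hookColumns P r c) :
    (q.1 = r ∧ c < q.2 ∧ q.2 ∈ levels P) ∨ (q.2 = c ∧ r ≤ q.1 ∧ q.1 + r ≤ c + 1) ∨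
      (q.2 = c - 1 ∧ c - 1 ∈ levels P ∧ r ≤ q.1 ∧ q.1 + r ≤ c) ∨
      (q.1 = q.2 + 1 - r ∧ c < q.2 ∧ q.2 ∈ levels P) := by
  simp only [hookColumns, List.mem_append, List.mem_map, List.mem_reverse, mem_levelsFrom] at h
  rcases h with (⟨ℓ, ⟨h1, h2⟩, rfl⟩ | h) | ⟨ℓ, ⟨h1, h2⟩, rfl⟩
  · exact .inl ⟨rfl, h1.1, h2⟩
  · rcases mem_turnColumns h with h | h
    · exact .inr (.inl h)
    · exact .inr (.inr (.inl h))
  · exact .inr (.inr (.inr ⟨rfl, h1.1, h2⟩))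

lemma turnColumns_head {r c : ℕ} (h : 2 * r ≤ c + 1) :
    (turnColumns P r c).head? = some (r, c) := by
  obtain ⟨m, hm⟩ : ∃ m, c + 2 - 2 * r = m + 1 := ⟨c + 1 - 2 * r, by omega⟩
  rw [turnColumns, hm, List.range'_succ, List.flatMap_cons]
  rfl

lemma turnColumns_getLast {r c : ℕ} (h : 2 * r ≤ c + 1) :
    (turnColumns P r c).getLast? = some (c + 1 - r, c) := by
  obtain ⟨m, hm⟩ : ∃ m, c + 2 - 2 * r = m + 1 := ⟨c + 1 - 2 * r, by omega⟩
  rw [turnColumns, hm, List.range'_concat, List.flatMap_append, List.flatMap_singleton,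
    if_neg (by omega), List.getLast?_append, List.getLast?_singleton]
  simp only [Option.some_or, Option.some.injEq, Prod.mk.injEq, and_true]
  omega

lemma turnColumns_isChain {r c : ℕ} {R : ℕ × ℕ → ℕ × ℕ → Prop}
    (h1 : ∀ u, r ≤ u → u + r ≤ c → c - 1 ∈ levels P →
      R (u, c) (u, c - 1) ∧ R (u, c - 1) (u + 1, c))
    (h2 : ∀ u, r ≤ u → u + r ≤ c → c - 1 ∉ levels P → R (u, c) (u + 1, c)) :
    (turnColumns P r c).IsChain R := by
  rw [turnColumns, List.flatMap_def, List.isChain_flatten, List.isChain_map]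
  · constructor
    · intro l hl
      obtain ⟨u, hu, rfl⟩ := List.mem_map.1 hl
      rw [List.mem_range'_1] at hu
      split_ifs with h
      · simpa using (h1 u hu.1 h.1 h.2).1
      · simp
    · refine List.isChain_iff_getElem.2 fun j hj => ?_
      rw [List.length_range'] at hj
      rw [List.getElem_range', List.getElem_range', one_mul, one_mul]
      intro x hx y hy
      obtain rfl : (r + (j + 1), c) = y := by simpa using hy
      by_cases hc : c - 1 ∈ levels P
      · rw [if_pos ⟨by omega, hc⟩] at hx
        obtain rfl : (r + j, c - 1) = x := by simpa using hx
        exact (h1 (r + j) (by omega) (by omega) hc).2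
      · rw [if_neg (by tauto)] at hx
        obtain rfl : (r + j, c) = x := by simpa using hx
        exact h2 (r + j) (by omega) (by omega) hc
  · simp

lemma hookColumns_isChain {r c : ℕ} (hr : 2 * r ≤ c + 1) (hc : c ∈ levels P)
    {R : ℕ × ℕ → ℕ × ℕ → Prop}
    (hdown : ∀ i j, i ∈ levels P → c ≤ i → NextLevel P i j → R (r, j) (r, i))
    (hup : ∀ i j, i ∈ levels P → c ≤ i → NextLevel P i j → R (i + 1 - r, i) (j + 1 - r, j))
    (h1 : ∀ u, r ≤ u → u + r ≤ c → c - 1 ∈ levels P →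
      R (u, c) (u, c - 1) ∧ R (u, c - 1) (u + 1, c))
    (h2 : ∀ u, r ≤ u → u + r ≤ c → c - 1 ∉ levels P → R (u, c) (u + 1, c)) :
    (hookColumns P r c).IsChain R := by
  have hF : (levelsFrom P (c + 1) (n - c)).IsChain
      fun i j => i ∈ levels P ∧ c ≤ i ∧ NextLevel P i j := by
    refine List.isChain_iff_getElem.2 fun j hj => ?_
    have h := List.isChain_iff_getElem.1 (levelsFrom_isChain (P := P) (c + 1) (n - c)) j hj
    have h' := (mem_levelsFrom.1 (List.getElem_mem (Nat.lt_of_succ_lt hj))).1.1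
    exact ⟨h.1, by omega, h.2⟩
  rw [hookColumns, List.isChain_append, List.isChain_append, List.isChain_map,
    List.isChain_map, List.isChain_reverse]
  refine ⟨⟨hF.imp fun i j h => hdown i j h.1 h.2.1 h.2.2, turnColumns_isChain h1 h2, ?_⟩,
    hF.imp fun i j h => hup i j h.1 h.2.1 h.2.2, ?_⟩
  · intro x hx y hy
    rw [turnColumns_head hr] at hy
    obtain rfl : (r, c) = y := by simpa using hy
    rw [List.getLast?_map, List.getLast?_reverse] at hx
    obtain ⟨j, hj, rfl⟩ := Option.mem_map.1 hx
    exact hdown c j hc le_rfl (levelsFrom_head hj)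
  · intro x hx y hy
    rw [List.getLast?_append, turnColumns_getLast hr, Option.some_or] at hx
    obtain rfl : (c + 1 - r, c) = x := by simpa using hx
    rw [List.head?_map] at hy
    obtain ⟨j, hj, rfl⟩ := Option.mem_map.1 hy
    exact hup c j hc le_rfl (levelsFrom_head hj)

lemma le_of_mem_levels {i : ℕ} (hi : i ∈ levels P) : i ≤ n := by
  have := Multiset.le_sum_of_mem (Multiset.mem_toFinset.1 hi)
  rwa [P.parts_sum] at this

lemma hookColumns_head {r c : ℕ} (hr : 2 * r ≤ c + 1) (hc : c ∈ levels P) :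
    ∃ m, (hookColumns P r c).head? = some (r, m) ∧ c ≤ m ∧ m ∈ levels P ∧
      ∀ k ∈ levels P, k ≤ m := by
  have hcn := le_of_mem_levels hc
  rw [hookColumns, List.append_assoc, List.head?_append, List.head?_map, List.head?_reverse,
    List.head?_append, turnColumns_head hr, Option.some_or]
  cases hl : (levelsFrom P (c + 1) (n - c)).getLast? with
  | none =>
    refine ⟨c, rfl, le_rfl, hc, fun k hk => ?_⟩
    by_contra hlt
    have : k ∈ levelsFrom P (c + 1) (n - c) :=
      mem_levelsFrom.2 ⟨⟨by omega, by have := le_of_mem_levels hk; omega⟩, hk⟩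
    rw [List.getLast?_eq_none_iff.1 hl] at this
    simp at this
  | some m =>
    have hm := mem_levelsFrom.1 (List.mem_of_getLast? hl)
    exact ⟨m, rfl, by omega, hm.2, fun k hk =>
      levelsFrom_getLast hl hk (by have := le_of_mem_levels hk; omega)⟩

lemma hookChain_head {r c : ℕ} (hr : 2 * r ≤ c + 1) (hr1 : 1 ≤ r) (hc : c ∈ levels P)
    {v : Vertex P} (hv : v ∈ (hookChain P r c).head?) :
    v.pos = r ∧ v.height = 1 ∧ ∀ k ∈ levels P, k ≤ v.level := by
  obtain ⟨m, hm, hcm, hmS, hmax⟩ := hookColumns_head hr hc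
  rw [hookChain_eq] at hv
  obtain ⟨Q, hQ⟩ : ∃ Q, hookColumns P r c = (r, m) :: Q := by
    cases h : hookColumns P r c with
    | nil => rw [h] at hm; simp at hm
    | cons q Q =>
      rw [h] at hm
      obtain rfl : q = (r, m) := by simpa using hm
      exact ⟨Q, rfl⟩
  rw [hQ, List.flatMap_cons, List.head?_append_of_ne_nil _
    (column_ne_nil hmS hr1 (by show r ≤ m; omega)).1] at hv
  obtain ⟨h1, h2, h3⟩ := column_head hv
  exact ⟨h1, h3, h2 ▸ hmax⟩

/-! ### Consequences of maximality -/

lemma mem_uSet_two {𝔄 : Fin 2 → ℕ} {v : Vertex P} : v ∈ uSet P 𝔄 ↔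
    (v.level = 𝔄 0 ∨ v.level + 1 = 𝔄 0) ∨ (v.level = 𝔄 1 ∨ v.level + 1 = 𝔄 1) ∨
      (𝔄 0 < v.level ∧ 𝔄 1 < v.level ∧ (v.pos ≤ 2 ∨ v.level ≤ v.pos + 1)) ∨
      ((𝔄 0 < v.level ∨ 𝔄 1 < v.level) ∧ (v.pos ≤ 1 ∨ v.level ≤ v.pos)) := by
  have h : v ∈ uSet P 𝔄 ↔ (∃ i, v.level = 𝔄 i ∨ v.level + 1 = 𝔄 i) ∨ ((∃ i, 𝔄 i < v.level) ∧
      (v.pos ≤ (Finset.univ.filter fun i => 𝔄 i < v.level).card ∨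
        v.level + 1 ≤ v.pos + (Finset.univ.filter fun i => 𝔄 i < v.level).card)) := Iff.rfl
  have hcard : (Finset.univ.filter fun i => 𝔄 i < v.level).card =
      (if 𝔄 0 < v.level then 1 else 0) + (if 𝔄 1 < v.level then 1 else 0) := by
    rw [Finset.card_filter, Fin.sum_univ_two]
  rw [h, hcard, Fin.exists_fin_two, Fin.exists_fin_two]
  split_ifs <;> omega

lemma exists_vertex {u i : ℕ} (hi : i ∈ levels P) (h1 : 1 ≤ u) (h2 : u ≤ i) :
    ∃ v : Vertex P, v.pos = u ∧ v.level = i := by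
  obtain ⟨v, hv⟩ := List.exists_mem_of_ne_nil _ (column_ne_nil hi h1 h2).1
  exact ⟨v, mem_column.1 hv⟩

/-- A maximal pair `(a, b)` admits no pair `(a', b')` whose vertex set contains that of `(a, b)`
and a further vertex in position `u` and on the level `i`. -/
lemma not_uSet_bigger {𝔄 : Fin 2 → ℕ} (h : IsMaximalUTuple P 𝔄) {a' b' u i : ℕ}
    (ha' : a' ∈ levels P) (hb' : b' ∈ levels P) (hab' : b' + 2 ≤ a')
    (hsub : ∀ v : Vertex P, v ∈ uSet P 𝔄 → v ∈ uSet P ![a', b'])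
    (hi : i ∈ levels P) (h1 : 1 ≤ u) (h2 : u ≤ i)
    (hin : ∀ v : Vertex P, v.pos = u → v.level = i → v ∈ uSet P ![a', b'])
    (hout : ∀ v : Vertex P, v.pos = u → v.level = i → v ∉ uSet P 𝔄) : False := by
  obtain ⟨v, hv1, hv2⟩ := exists_vertex hi h1 h2
  refine h.2 ![a', b'] ⟨?_, ?_⟩ ⟨hsub, fun hs => hout v hv1 hv2 (hs (hin v hv1 hv2))⟩
  · intro i; fin_cases i
    · exact ha'
    · exact hb'
  · intro i j hij
    fin_cases i <;> fin_cases j <;> simp_all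

lemma mem_oddMinima_singleton {i : ℕ} (hi : i ∈ levels P) (h1 : i - 1 ∉ levels P)
    (h2 : i + 1 ∉ levels P) : i ∈ oddMinima P :=
  Finset.mem_filter.2 ⟨hi, i, hi, ⟨le_rfl, by simpa using hi, h1, h2⟩, by simp⟩

lemma mem_oddMinima_triple {i : ℕ} (h0 : i ∈ levels P) (h1 : i + 1 ∈ levels P)
    (h2 : i + 2 ∈ levels P) (h3 : i - 1 ∉ levels P) (h4 : i + 3 ∉ levels P) :
    i ∈ oddMinima P := by
  refine Finset.mem_filter.2 ⟨h0, i + 2, h2, ⟨by omega, fun j hj => ?_, h3, h4⟩, ?_⟩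
  · rw [Finset.mem_Icc] at hj
    obtain rfl | rfl | rfl : j = i ∨ j = i + 1 ∨ j = i + 2 := by omega
    exacts [h0, h1, h2]
  · rw [Nat.card_Icc, show i + 2 + 1 - i = 3 by omega]
    decide

section Maximal

variable {𝔄 : Fin 2 → ℕ}

/-- If `a - 1` is not a part and `a ≥ 4`, then `a` is isolated in `S_P`: otherwise `(a + 1, b)`
gives a larger set. -/
lemma mem_oddMinima_upper (h : IsMaximalUTuple P 𝔄) (h1 : 𝔄 0 - 1 ∉ levels P)
    (h4 : 4 ≤ 𝔄 0) : 𝔄 0 ∈ oddMinima P := by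
  have hab : 𝔄 1 + 2 ≤ 𝔄 0 := h.1.2 0 1 (by decide)
  by_cases h2 : 𝔄 0 + 1 ∈ levels P
  · exfalso
    refine not_uSet_bigger h (u := 3) h2 (h.1.1 1) (by omega) (fun v hv => ?_) h2 (by omega)
      (by omega) (fun v _ hv => ?_) fun v hv hv' => ?_
    · have hl : v.level + 1 ≠ 𝔄 0 := fun he => h1 (by
        rw [← he, Nat.add_sub_cancel]; exact v.bounds.1)
      rw [mem_uSet_two] at hv ⊢
      simp only [Matrix.cons_val_zero, Matrix.cons_val_one]
      omega
    · rw [mem_uSet_two]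
      exact .inl (.inl hv)
    · rw [mem_uSet_two]
      omega
  · exact mem_oddMinima_singleton (h.1.1 0) h1 h2

/-- If `b - 1` is not a part and `b ≥ 2`, then the maximal sequence of consecutive parts starting
at `b` is `{b}` or `{b, b + 1, b + 2}`: otherwise `(a, b + 1)` or `(b + 3, b + 1)` gives a larger
set. -/
lemma mem_oddMinima_lower (h : IsMaximalUTuple P 𝔄) (h1 : 𝔄 1 - 1 ∉ levels P)
    (h2 : 2 ≤ 𝔄 1) : 𝔄 1 ∈ oddMinima P := by
  have hab : 𝔄 1 + 2 ≤ 𝔄 0 := h.1.2 0 1 (by decide)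
  have hl : ∀ v : Vertex P, v.level + 1 ≠ 𝔄 1 := fun v he => h1 (by
    rw [← he, Nat.add_sub_cancel]; exact v.bounds.1)
  by_cases h3 : 𝔄 1 + 1 ∈ levels P
  · rcases Nat.eq_or_lt_of_le hab with he | hlt
    · by_cases h5 : 𝔄 1 + 3 ∈ levels P
      · exfalso
        refine not_uSet_bigger h (u := 3) h5 h3 (by omega) (fun v hv => ?_) h5 (by omega)
          (by omega) (fun v _ hv => ?_) fun v hv hv' => ?_
        · have := hl v
          rw [mem_uSet_two] at hv ⊢
          simp only [Matrix.cons_val_zero, Matrix.cons_val_one]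
          omega
        · rw [mem_uSet_two]
          exact .inl (.inl hv)
        · rw [mem_uSet_two]
          omega
      · exact mem_oddMinima_triple (h.1.1 1) h3 (he ▸ h.1.1 0) h1 h5
    · exfalso
      refine not_uSet_bigger h (u := 2) (h.1.1 0) h3 (by omega) (fun v hv => ?_) h3 (by omega)
        (by omega) (fun v _ hv => ?_) fun v hv hv' => ?_
      · have := hl v
        rw [mem_uSet_two] at hv ⊢
        simp only [Matrix.cons_val_zero, Matrix.cons_val_one]
        omega
      · rw [mem_uSet_two]
        exact .inr (.inl (.inl hv))
      · rw [mem_uSet_two]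
        omega
  · exact mem_oddMinima_singleton (h.1.1 1) h1 h3

end Maximal

/-! ### The component chains are tight -/

section Component

variable {a b r c : ℕ}

/-- The pairs `(r, c)` for which `hookChain P r c` is a component chain of `(a, b)`: the outer
chain `r = 1` turns at the level `b`, the inner chain `r = 2` at the level `a`. -/
def IsTurn (a b r c : ℕ) : Prop := (r = 1 ∧ c = b) ∨ (r = 2 ∧ c = a)

lemma onUChain_of_mem_hookChain (hab : b + 2 ≤ a) (hb : 1 ≤ b) (hrc : IsTurn a b r c)
    {w : Vertex P} (hw : w ∈ hookChain P r c) : OnUChain a b w.pos w.level := by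
  rw [hookChain_eq, List.mem_flatMap] at hw
  obtain ⟨q, hq, hw⟩ := hw
  obtain ⟨h1, h2⟩ := mem_column.1 hw
  have := mem_hookColumns hq
  rw [h1, h2]
  unfold OnUChain
  unfold IsTurn at hrc
  omega

lemma hookChain_tight (hab : b + 2 ≤ a) (ha : a ∈ levels P) (hbS : b ∈ levels P)
    (hrc : IsTurn a b r c) (hodd : c - 1 ∉ levels P → 2 * r ≤ c → c ∈ oddMinima P) :
    (hookChain P r c).IsChain (Tight (cost P a b) (pot P a b)) := by
  have hb := one_le_of_mem_levels hbS
  have hc : c ∈ levels P := by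
    rcases hrc with ⟨-, rfl⟩ | ⟨-, rfl⟩
    exacts [hbS, ha]
  have hrc' := hrc
  unfold IsTurn at hrc
  have hr : 2 * r ≤ c + 1 := by omega
  rw [hookChain_eq]
  refine isChain_flatMap_column ?_ ?_ (hookColumns_isChain hr hc ?_ ?_ ?_ ?_)
  · intro v w h1 h2 h3
    have hv := v.bounds
    have hw := w.bounds
    rw [h1] at hw
    have hk : v.height - 1 < mult P v.level - 1 := by omega
    have hx : Step P (.e ⟨v.level, hv.1⟩ ⟨v.height - 1, hk⟩) v w :=
      ⟨rfl, by simp only; omega, h1, by simp only; omega, h2⟩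
    exact ⟨_, hx, pot_e hx⟩
  · intro q hq
    have hlev : ∀ {i : ℕ}, i ∈ levels P → 1 ≤ i := one_le_of_mem_levels
    rcases mem_hookColumns hq with ⟨h1, h2, h3⟩ | ⟨h1, h2, h3⟩ | ⟨h1, h2, h3, h4⟩ | ⟨h1, h2, h3⟩
    · exact ⟨h3, by omega, by omega⟩
    · exact ⟨h1 ▸ hc, by omega, by omega⟩
    · exact ⟨h1 ▸ h2, by omega, by omega⟩
    · exact ⟨h3, by omega, by omega⟩
  · intro i j hi hci ⟨hij, hj, hnext⟩ v w hv1 hv2 hv3 hw1 hw2 hw3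
    obtain ⟨hju, hpj⟩ := eq_prevLevel hi hj hij hnext
    simp only at hv1 hv2 hv3 hw1 hw2
    have hx : Step P (.s ⟨j, hju⟩) v w :=
      ⟨hv2, hv3, by simp only; omega, hw3, by omega⟩
    exact ⟨_, hx, (pot_s hab ha hbS hx).2.2 (by omega)⟩
  · intro i j hi hci ⟨hij, hj, hnext⟩ v w hv1 hv2 hv3 hw1 hw2 hw3
    obtain ⟨hju, hpj⟩ := eq_prevLevel hi hj hij hnext
    simp only at hv1 hv2 hv3 hw1 hw2
    have hx : Step P (.t ⟨j, hju⟩) v w :=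
      ⟨by simp only; omega, by simp only [hpj, hv3], hw2, hw3, by simp only; omega⟩
    exact ⟨_, hx, (pot_t hab ha hbS hx).2.2 (by omega)⟩
  · intro u hu1 hu2 hc1
    obtain ⟨hju, hpj⟩ := eq_prevLevel hc1 hc (by omega) fun k _ hk => by omega
    constructor
    · intro v w hv1 hv2 hv3 hw1 hw2 hw3
      simp only at hv1 hv2 hv3 hw1 hw2
      have hx : Step P (.s ⟨c, hju⟩) v w :=
        ⟨hv2, hv3, by simp only; omega, hw3, by omega⟩
      exact ⟨_, hx, (pot_s hab ha hbS hx).2.2 (by omega)⟩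
    · intro v w hv1 hv2 hv3 hw1 hw2 hw3
      simp only at hv1 hv2 hv3 hw1 hw2
      have hx : Step P (.t ⟨c, hju⟩) v w :=
        ⟨by simp only; omega, by simp only [hpj, hv3], hw2, hw3, by simp only; omega⟩
      refine ⟨_, hx, (pot_t hab ha hbS hx).2.2 ?_⟩
      rcases hrc with ⟨rfl, rfl⟩ | ⟨rfl, rfl⟩
      · exact .inr (.inr (.inr ⟨hw2, hc1⟩))
      · exact .inr (.inr (.inl ⟨by omega, hw2, hc1⟩))
  · intro u hu1 hu2 hc1 v w hv1 hv2 hv3 hw1 hw2 hw3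
    simp only at hv1 hv2 hv3 hw1 hw2
    have hx : Step P (.z ⟨c, hodd hc1 (by omega)⟩) v w :=
      ⟨hv2, hv3, hw2, hw3, by omega⟩
    exact ⟨_, hx, (pot_z hab hx).2.2 ⟨hw2 ▸ hc1, by omega⟩⟩

lemma not_tight_hookChain_head (hab : b + 2 ≤ a) (ha : a ∈ levels P) (hbS : b ∈ levels P)
    (hrc : IsTurn a b r c) {w : Vertex P} (hw : w ∈ (hookChain P r c).head?) (v : Vertex P) :
    ¬ Tight (cost P a b) (pot P a b) v w := by
  intro hT
  have hb := one_le_of_mem_levels hbS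
  have hc : c ∈ levels P := by
    rcases hrc with ⟨-, rfl⟩ | ⟨-, rfl⟩
    exacts [hbS, ha]
  unfold IsTurn at hrc
  obtain ⟨h1, h2, h3⟩ := hookChain_head (by omega) (by omega) hc hw
  have hv := v.bounds
  have hv' := h3 _ hv.1
  have ha' := h3 _ ha
  rcases tight_cases hab ha hbS hT with h | h | h | h
  · omega
  · omega
  · omega
  · omega

end Component

lemma initVert_mem_head {s : ℕ} {𝔄 : Fin s → ℕ} (x : Idx P 𝔄) :
    initVert P 𝔄 x ∈ (component P 𝔄 x.1).head? := by
  rw [List.head?_eq_getElem?, List.getElem?_eq_getElem x.2.pos]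
  rfl

/-- The standard triple is a chain factorization of `± μ_𝔄`, and the only one. -/
lemma standardTriple_unique {𝔄 : Fin 2 → ℕ} (h𝔄 : IsMaximalUTuple P 𝔄) :
    IsChainFactorization P 𝔄 (standardTriple P 𝔄) (distinguishedExp P 𝔄) ∧
      ∀ f : Triple P 𝔄, IsChainFactorization P 𝔄 f (distinguishedExp P 𝔄) →
        f = standardTriple P 𝔄 := by
  have hab : 𝔄 1 + 2 ≤ 𝔄 0 := h𝔄.1.2 0 1 (by decide)
  have ha := h𝔄.1.1 0
  have hb := h𝔄.1.1 1
  have hturn : ∀ r : Fin 2, IsTurn (𝔄 0) (𝔄 1) (r + 1) (𝔄 r.rev) := by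
    intro r
    fin_cases r
    · exact .inl ⟨rfl, rfl⟩
    · exact .inr ⟨rfl, rfl⟩
  have hchain : ∀ r, (component P 𝔄 r).IsChain
      (Tight (cost P (𝔄 0) (𝔄 1)) (pot P (𝔄 0) (𝔄 1))) := by
    intro r
    refine hookChain_tight hab ha hb (hturn r) ?_
    fin_cases r
    · exact fun h1 h2 => mem_oddMinima_lower h𝔄 h1 h2
    · exact fun h1 h2 => mem_oddMinima_upper h𝔄 h1 h2
  have hhead : ∀ x : Idx P 𝔄, (initVert P 𝔄 x).pos = x.1 + 1 := fun x => by
    have hb' := one_le_of_mem_levels hb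
    have ht := hturn x.1
    unfold IsTurn at ht
    exact (hookChain_head (by omega) (by omega) (h𝔄.1.1 _) (initVert_mem_head x)).1
  refine ⟨⟨standardChain_isAugChain fun r => (hchain r).imp fun _ _ ⟨x, hx, _⟩ => ⟨x, hx⟩,
    fun _ => rfl, rfl⟩, fun f hf => ?_⟩
  refine eq_standardTriple_of_potential (pot_le_of_step hab ha hb) hchain
    (fun r w hw v v' => tight_pred_unique hab ha hb
      (onUChain_of_mem_hookChain hab (one_le_of_mem_levels hb) (hturn r) hw))
    (fun x v => not_tight_hookChain_head hab ha hb (hturn x.1) (initVert_mem_head x) v)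
    (fun x y hxy => ?_) hf
  have := hhead x
  rw [hxy, hhead y] at this
  exact Fin.ext (by omega)

end JordanBound

theorem proposition3p5 {𝕜 : Type*} [Field 𝕜] {n : ℕ} (P : n.Partition) (𝔄 : Fin 2 → ℕ)
    (h𝔄 : JordanBound.IsMaximalUTuple P 𝔄) :
    JordanBound.IsChainFactorization P 𝔄 (JordanBound.standardTriple P 𝔄)
        (JordanBound.distinguishedExp P 𝔄) ∧
      (∀ f : JordanBound.Triple P 𝔄,
        JordanBound.IsChainFactorization P 𝔄 f (JordanBound.distinguishedExp P 𝔄) →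
          f = JordanBound.standardTriple P 𝔄) ∧
      MvPolynomial.coeff (JordanBound.distinguishedExp P 𝔄)
        (JordanBound.uMatrix P 𝔄 𝕜).det = 1 := by
  obtain ⟨hstd, huniq⟩ := JordanBound.standardTriple_unique h𝔄
  exact ⟨hstd, huniq, JordanBound.coeff_det_eq_one 𝕜 hstd huniq⟩
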